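/- **Setting.** Let $(Z_t)_{t\in\mathbb Z}$ be i.i.d. real random variables on a probability space with $\mathbb E Z_0=0$, $\mathbb E Z_0^2=1$, and let $\mathcal F_t=\sigma(Z_k;\,k\le t)$. Let $p,q\ge 0$ be integers, $\alpha_0>0$, $\alpha_1,\dots,\alpha_p,\beta_1,\dots,\beta_q\ge 0$ and $|\gamma|\le 1$. A solution of the AGARCH$(p,q)$ equations is a process $((X_t,\sigma_t))_{t\in\mathbb Z}$ on this probability space such that almost surely, for all $t\in\mathbb Z$, $\sigma_t\ge 0$ and $$X_t=\sigma_t Z_t,\qquad \sigma_t^2=\alpha_0+\sum_{i=1}^p\alpha_i(|X_{t-i}|-\gamma X_{t-i})^2+\sum_{j=1}^q\beta_j\sigma_{t-j}^2 .$$ "Stationary" means that $((X_t,\sigma_t))$ is strictly stationary, and uniqueness is up to indistinguishability (any two such processes agree for all $t$ simultaneously, almost surely). For $p,q\ge1$ put $$\mathbf Y_t=\big(\sigma_t^2,\dots,\sigma_{t-q+1}^2,(|X_{t-1}|-\gamma X_{t-1})^2,\dots,(|X_{t-p+1}|-\gamma X_{t-p+1})^2\big)^T\in\mathbb R^{p+q-1},\qquad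 \mathbf B=(\alpha_0,0,\dots,0)^T\in\mathbb R^{p+q-1},$$ and let $\mathbf A_t$ be the $(p+q-1)\times(p+q-1)$ matrix with first row $(\alpha_1(|Z_t|-\gamma Z_t)^2+\beta_1,\beta_2,\dots,\beta_q,\alpha_2,\dots,\alpha_p)$; rows $k=2,\dots,q$ with a single nonzero entry $1$, in column $k-1$; row $q+1$ (if $p\ge2$) with the single possibly nonzero entry $(|Z_t|-\gamma Z_t)^2$, in column $1$; and rows $k=q+2,\dots,q+p-1$ with a single nonzero entry $1$, in column $k-1$. If $p=0$ (respectively $q=0$), these objects are formed as for $p=1$ with $\alpha_1=0$ (respectively $q=1$ with $\beta_1=0$). Then $(\mathbf A_t)$ is i.i.d. Its top Lyapunov exponent is $$\rho=\lim_{n\to\infty}\frac1{n+1}\,\mathbb E\big(\log\|\mathbf A_0\mathbf A_{-1}\cdots\mathbf A_{-n+1}\|_{\mathrm{op}}\big)\in[-\infty,\infty),$$ where $\|\cdot\|_{\mathrm{op}}$ is the operator norm for the Euclidean norm and $\log 0=-\infty$. **Theorem.** 1. The limit $\rho$ exists, and the AGARCH$(p,q)$ equations have a unique stationary solution if and only if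 $\rho<0$. 2. Every stationary solution $((X_t,\sigma_t))$ is ergodic; for each $t$, $\sigma_t$ is $\mathcal F_{t-1}$-measurable (that is, almost surely equal to an $\mathcal F_{t-1}$-measurable random variable); and almost surely, for all $t\in\mathbb Z$, $$\mathbf Y_t=\sum_{k=0}^\infty\Big(\prod_{l=1}^k\mathbf A_{t-l}\Big)\mathbf B,$$ where $\prod_{l=1}^k\mathbf A_{t-l}=\mathbf A_{t-1}\mathbf A_{t-2}\cdots\mathbf A_{t-k}$, the empty product is the identity, and the series converges unconditionally. 3. If a stationary solution exists, then $\sum_{j=1}^q\beta_j<1$. 4. The condition $$\sum_{i=1}^p\alpha_i\,\mathbb E\big[(|Z_0|-\gamma Z_0)^2\big]+\sum_{j=1}^q\beta_j<1$$ holds if and only if there is a unique stationary solution with $\mathbb E X_t^2<\infty$ for all $t$. It also holds if and only if there is a unique stationary solution with $\mathbb E X_t^2<\infty$ and $\mathbb E\sigma_t^2<\infty$ for all $t$. -/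

import Mathlib

open MeasureTheory ProbabilityTheory Filter Topology
open scoped ENNReal Matrix

noncomputable section

/-! ### Strict stationarity, ergodicity, the past of a process -/

/-- The process `V`, indexed by `ℤ`, is strictly stationary: the law of its path in `E^ℤ`
is invariant under all time shifts. -/
def IsStationaryProcess {Ω E : Type*} [MeasurableSpace Ω] [MeasurableSpace E]
    (P : Measure Ω) (V : ℤ → Ω → E) : Prop :=
  ∀ h : ℤ, IdentDistrib (fun ω t => V (t + h) ω) (fun ω t => V t ω) P P

/-- The time shift on path space. -/
def pathShift {E : Type*} (v : ℤ → E) : ℤ → E := fun t => v (t + 1)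

/-- The process `V` is stationary and ergodic: the shift on path space is
ergodic (in particular, measure preserving) for the law of `V`. -/
def IsErgodicProcess {Ω E : Type*} [MeasurableSpace Ω] [MeasurableSpace E]
    (P : Measure Ω) (V : ℤ → Ω → E) : Prop :=
  Ergodic pathShift (P.map (fun ω t => V t ω))

/-- The σ-field `F_t = σ(Z_k ; k ≤ t)`. -/
@[reducible] def pastSigma {Ω : Type*} (Z : ℤ → Ω → ℝ) (t : ℤ) : MeasurableSpace Ω :=
  ⨆ k : ℤ, ⨆ _ : k ≤ t, MeasurableSpace.comap (Z k) inferInstance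

/-! ### The AGARCH(p, q) equations -/

/-- The function `x ↦ (|x| - γ x)²`. -/
def asymSq (γ x : ℝ) : ℝ := (|x| - γ * x) ^ 2

/-- `(X, σ)` is a solution of the AGARCH(p, q) equations driven by `Z`. Here `α i` and `β j`
are the coefficients that are usually numbered `α_{i+1}` and `β_{j+1}`. -/
structure IsAGARCHSolution {Ω : Type*} [MeasurableSpace Ω] (P : Measure Ω) (Z : ℤ → Ω → ℝ)
    {p q : ℕ} (α₀ : ℝ) (α : Fin p → ℝ) (β : Fin q → ℝ) (γ : ℝ)
    (X σ : ℤ → Ω → ℝ) : Prop where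
  measurable_X : ∀ t, Measurable (X t)
  measurable_σ : ∀ t, Measurable (σ t)
  nonneg : ∀ᵐ ω ∂P, ∀ t, 0 ≤ σ t ω
  eq_X : ∀ᵐ ω ∂P, ∀ t, X t ω = σ t ω * Z t ω
  eq_σ : ∀ᵐ ω ∂P, ∀ t, σ t ω ^ 2 =
    α₀ + ∑ i : Fin p, α i * asymSq γ (X (t - ((i : ℕ) + 1)) ω)
       + ∑ j : Fin q, β j * σ (t - ((j : ℕ) + 1)) ω ^ 2

/-- `((X_t, σ_t))` is a stationary AGARCH(p, q) process. -/
def IsStationaryAGARCH {Ω : Type*} [MeasurableSpace Ω] (P : Measure Ω) (Z : ℤ → Ω → ℝ)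
    {p q : ℕ} (α₀ : ℝ) (α : Fin p → ℝ) (β : Fin q → ℝ) (γ : ℝ)
    (X σ : ℤ → Ω → ℝ) : Prop :=
  IsAGARCHSolution P Z α₀ α β γ X σ ∧ IsStationaryProcess P (fun t ω => (X t ω, σ t ω))

/-- There is a pair of processes with the property `S`, and any two pairs of processes with
the property `S` are indistinguishable. -/
def ExistsUniqueProcess {Ω : Type*} [MeasurableSpace Ω] (P : Measure Ω)
    (S : (ℤ → Ω → ℝ) → (ℤ → Ω → ℝ) → Prop) : Prop :=
  (∃ X σ, S X σ) ∧
    ∀ X σ X' σ', S X σ → S X' σ' → ∀ᵐ ω ∂P, ∀ t, X t ω = X' t ω ∧ σ t ω = σ' t ω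

/-! ### The linear stochastic recurrence equation -/

/-- A coefficient sequence extended by zeros. -/
def padCoeff {n : ℕ} (a : Fin n → ℝ) (i : ℕ) : ℝ := if h : i < n then a ⟨i, h⟩ else 0

/-- Coordinates of the state vector: `q` squared volatilities followed by `p - 1` terms
`(|X| - γ X)²`. The current squared volatility is always present: `p = 0` is
read as `p = 1` with zero coefficient `α_1`, and `q = 0` as `q = 1` with zero coefficient `β_1`. -/
abbrev AGARCHIdx (p q : ℕ) : Type := Fin (max q 1) ⊕ Fin (p - 1)

/-- The state vector
`Y_t = (σ_t², …, σ_{t-q+1}², (|X_{t-1}| - γ X_{t-1})², …, (|X_{t-p+1}| - γ X_{t-p+1})²)ᵀ`. -/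
def agarchState (p q : ℕ) {Ω : Type*} (γ : ℝ) (X σ : ℤ → Ω → ℝ) (t : ℤ) (ω : Ω) :
    AGARCHIdx p q → ℝ
  | .inl j => σ (t - (j : ℕ)) ω ^ 2
  | .inr i => asymSq γ (X (t - ((i : ℕ) + 1)) ω)

/-- The matrix `A_t`, as a function of the value `z` of `Z_t`. -/
def agarchMatrix {p q : ℕ} (α : Fin p → ℝ) (β : Fin q → ℝ) (γ : ℝ) (z : ℝ) :
    Matrix (AGARCHIdx p q) (AGARCHIdx p q) ℝ :=
  Matrix.of fun
    -- first row
    | .inl ⟨0, _⟩, .inl j =>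
        (if (j : ℕ) = 0 then padCoeff α 0 * asymSq γ z else 0) + padCoeff β j
    | .inl ⟨0, _⟩, .inr i => padCoeff α (i + 1)
    -- shift of the squared volatilities
    | .inl ⟨k + 1, _⟩, .inl j => if (j : ℕ) = k then 1 else 0
    | .inl ⟨_ + 1, _⟩, .inr _ => 0
    -- row of the new term `(|X_t| - γ X_t)² = (|Z_t| - γ Z_t)² σ_t²`
    | .inr ⟨0, _⟩, .inl j => if (j : ℕ) = 0 then asymSq γ z else 0
    | .inr ⟨0, _⟩, .inr _ => 0
    -- shift of the remaining terms
    | .inr ⟨_ + 1, _⟩, .inl _ => 0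
    | .inr ⟨k + 1, _⟩, .inr i => if (i : ℕ) = k then 1 else 0

/-- The vector `B_t = (α_0, 0, …, 0)ᵀ`; it does not depend on `t`. -/
def agarchVec (p q : ℕ) (α₀ : ℝ) : AGARCHIdx p q → ℝ
  | .inl j => if (j : ℕ) = 0 then α₀ else 0
  | .inr _ => 0

/-- The ordered product `A_{t-1} A_{t-2} ⋯ A_{t-k}`, equal to the identity if `k = 0`. -/
def agarchProd {Ω : Type*} {p q : ℕ} (α : Fin p → ℝ) (β : Fin q → ℝ) (γ : ℝ)
    (Z : ℤ → Ω → ℝ) (t : ℤ) (k : ℕ) (ω : Ω) :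
    Matrix (AGARCHIdx p q) (AGARCHIdx p q) ℝ :=
  ((List.range k).map fun l : ℕ => agarchMatrix α β γ (Z (t - ((l : ℤ) + 1)) ω)).prod

/-! ### The top Lyapunov exponent -/

/-- `E[f]` for an extended-real random variable `f`: the integral of the positive part minus
the integral of the negative part. (If both are infinite, the value is `-∞`; this
does not occur below, where the positive part is integrable.) -/
def expectEReal {Ω : Type*} [MeasurableSpace Ω] (P : Measure Ω) (f : Ω → EReal) : EReal :=
  ((∫⁻ ω, (f ω).toENNReal ∂P : ℝ≥0∞) : EReal) - ((∫⁻ ω, (-f ω).toENNReal ∂P : ℝ≥0∞) : EReal)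

/-- `log ‖M‖_op ∈ [-∞, ∞)`, for the operator norm with respect to the Euclidean norm, with
`log 0 = -∞`. -/
def logOpNorm {ι : Type*} [Fintype ι] [DecidableEq ι] (M : Matrix ι ι ℝ) : EReal :=
  ENNReal.log ‖Matrix.toEuclideanCLM (𝕜 := ℝ) M‖ₑ

/-- `ρ` is the top Lyapunov exponent of `(A_t)`:
`ρ = lim_n (1 / (n + 1)) E[log ‖A_0 A_{-1} ⋯ A_{-n+1}‖_op]`, a limit in `[-∞, ∞]`. -/
def IsTopLyapunovExponent {Ω : Type*} [MeasurableSpace Ω] (P : Measure Ω) {p q : ℕ}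
    (α : Fin p → ℝ) (β : Fin q → ℝ) (γ : ℝ) (Z : ℤ → Ω → ℝ) (ρ : EReal) : Prop :=
  Tendsto (fun n : ℕ => ((1 / ((n : ℝ) + 1) : ℝ) : EReal) *
    expectEReal P (fun ω => logOpNorm (agarchProd α β γ Z 1 n ω))) atTop (𝓝 ρ)

end

noncomputable section

/-! ### Algebra of the matrices along a fixed path of the noise -/

/-! In terms of state vectors the model is the linear recursion Y_t = A_{t-1} Y_{t-1} + B with
nonnegative A_t and B. Unrolling it gives n terms of the series plus the remainder A_{t-1} ⋯ A_{t-n}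
Y_{t-n} (`eq_sum_add_pathProd_mulVec`), so everything depends on the growth of the products. The
pivot is `HasNegDrift`: E log ‖A_0 ⋯ A_{-n+1}‖ < 0 for some n ≥ 1. By Fekete's lemma ρ exists, and ρ
< 0 is equivalent to this condition (`exists_isTopLyapunovExponent`).

Sufficiency. Since (w^s - 1)/s → log w as s → 0, a negative mean logarithm gives a norm moment of
some order s ∈ (0, 1] below 1. Independence makes these moments submultiplicative, hence summable,
and the products are almost surely summable (`HasNegDrift.ae_summable`). The series then solves the
recursion and is a fixed function of the shifted noise, hence stationary.

Necessity (`IsStationaryAGARCH.hasNegDrift`). Along a stationary solution, the constants α₀ injected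
during one block of `memLength p q` steps make up at least a positive fraction δ_t of the state.
What is left of the older state is therefore at most (1 - δ_t) Y_t, and over n blocks the factors
multiply to at most exp(-∑ δ). One further block puts every basis vector below a multiple of the
state, so the matrix norms inherit the decay, with mean exponent -n E δ_0 up to bounded terms. The
state at the final time enters as a factor whose logarithm need not be integrable; it is truncated
on an event of small probability.

Representation and uniqueness. The products tend to 0, while a stationary state returns to bounded
sets, so the remainder vanishes and every stationary solution is the series
(`IsStationaryAGARCH.ae_hasSum`). Ergodicity passes from the i.i.d. shift to this function of the
noise, and the series at time t involves only earlier noise.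

Moments. The matrix entries are affine in (|z| - γ z)², so by independence the expected series is
the series along a constant noise path, bounded by a constant solution when the moment condition
holds. Conversely, S = E σ_t² satisfies S = α₀ + c S, where c is the left-hand side of the
condition, and finiteness of S forces c < 1. If ∑ β_j ≥ 1, iterating the volatility equation pushes
σ_t² above every bound. -/

/-- The product `A_{t-1} ⋯ A_{t-k}` along a deterministic path of the noise. -/
def pathProd {p q : ℕ} (α : Fin p → ℝ) (β : Fin q → ℝ) (γ : ℝ) (z : ℤ → ℝ) (t : ℤ) (k : ℕ) :
    Matrix (AGARCHIdx p q) (AGARCHIdx p q) ℝ :=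
  ((List.range k).map fun l : ℕ => agarchMatrix α β γ (z (t - ((l : ℤ) + 1)))).prod

lemma agarchProd_eq_pathProd {Ω : Type*} {p q : ℕ} (α : Fin p → ℝ) (β : Fin q → ℝ) (γ : ℝ)
    (Z : ℤ → Ω → ℝ) (t : ℤ) (k : ℕ) (ω : Ω) :
    agarchProd α β γ Z t k ω = pathProd α β γ (fun s => Z s ω) t k := rfl

section Path

variable {p q : ℕ} (α : Fin p → ℝ) (β : Fin q → ℝ) (γ : ℝ) (z : ℤ → ℝ)

/-- The first coordinate of the state vector. -/
abbrev idxZero (p q : ℕ) : AGARCHIdx p q := .inl ⟨0, by omega⟩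

instance nonempty_agarchIdx : Nonempty (AGARCHIdx p q) := ⟨idxZero p q⟩

@[simp] lemma pathProd_zero (t : ℤ) : pathProd α β γ z t 0 = 1 := rfl

lemma pathProd_succ (t : ℤ) (k : ℕ) :
    pathProd α β γ z t (k + 1) = agarchMatrix α β γ (z (t - 1)) * pathProd α β γ z (t - 1) k := by
  simp only [pathProd, List.range_succ_eq_map, List.map_cons, List.map_map, List.prod_cons]
  rw [show t - (((0 : ℕ) : ℤ) + 1) = t - 1 by simp]
  congr 1
  refine congrArg List.prod (List.map_congr_left fun l _ => ?_)
  simp only [Function.comp]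
  congr 2
  push_cast
  ring

lemma pathProd_add (t : ℤ) (m n : ℕ) :
    pathProd α β γ z t (m + n) = pathProd α β γ z t m * pathProd α β γ z (t - m) n := by
  induction m generalizing t with
  | zero => simp
  | succ m ih =>
    rw [show m + 1 + n = (m + n) + 1 by ring, pathProd_succ, pathProd_succ, ih, Matrix.mul_assoc,
      show t - 1 - (m : ℤ) = t - ((m + 1 : ℕ) : ℤ) by push_cast; ring]

lemma pathProd_shift (t h : ℤ) (k : ℕ) :
    pathProd α β γ (fun s => z (s + h)) t k = pathProd α β γ z (t + h) k := by
  simp only [pathProd]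
  congr 1
  refine List.map_congr_left fun l _ => ?_
  congr 2
  ring

lemma padCoeff_nonneg {n : ℕ} {a : Fin n → ℝ} (ha : ∀ i, 0 ≤ a i) (i : ℕ) : 0 ≤ padCoeff a i := by
  unfold padCoeff
  split_ifs
  exacts [ha _, le_rfl]

lemma asymSq_nonneg (x : ℝ) : 0 ≤ asymSq γ x := sq_nonneg _

lemma asymSq_mul_of_nonneg {s : ℝ} (hs : 0 ≤ s) (x : ℝ) :
    asymSq γ (s * x) = s ^ 2 * asymSq γ x := by
  simp only [asymSq, abs_mul, abs_of_nonneg hs]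
  ring

variable {α β} in
lemma agarchMatrix_nonneg (hα : ∀ i, 0 ≤ α i) (hβ : ∀ j, 0 ≤ β j) (x : ℝ) (i j : AGARCHIdx p q) :
    0 ≤ agarchMatrix α β γ x i j := by
  have h1 := padCoeff_nonneg hα
  have h2 := padCoeff_nonneg hβ
  have h3 := asymSq_nonneg γ x
  rcases i with ⟨_ | k, hk⟩ | ⟨_ | k, hk⟩ <;> rcases j with j | j <;>
    simp only [agarchMatrix, Matrix.of_apply]
  · have := h1 0
    have := h2 j
    split_ifs <;> positivity
  · exact h1 _
  · split_ifs <;> norm_num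
  · rfl
  · split_ifs <;> simp [h3]
  · rfl
  · rfl
  · split_ifs <;> norm_num

variable {α β} in
lemma pathProd_nonneg (hα : ∀ i, 0 ≤ α i) (hβ : ∀ j, 0 ≤ β j) (t : ℤ) (k : ℕ)
    (i j : AGARCHIdx p q) : 0 ≤ pathProd α β γ z t k i j := by
  induction k generalizing t i j with
  | zero =>
    rw [pathProd_zero, Matrix.one_apply]
    split_ifs <;> norm_num
  | succ k ih =>
    rw [pathProd_succ, Matrix.mul_apply]
    exact Finset.sum_nonneg fun l _ => mul_nonneg (agarchMatrix_nonneg γ hα hβ _ _ _) (ih _ _ _)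

lemma mulVec_nonneg_of_nonneg {ι : Type*} [Fintype ι] {M : Matrix ι ι ℝ} (hM : ∀ i j, 0 ≤ M i j)
    {v : ι → ℝ} (hv : ∀ i, 0 ≤ v i) (i : ι) : 0 ≤ (M *ᵥ v) i :=
  Finset.sum_nonneg fun j _ => mul_nonneg (hM i j) (hv j)

lemma mulVec_mono_of_nonneg {ι : Type*} [Fintype ι] {M : Matrix ι ι ℝ} (hM : ∀ i j, 0 ≤ M i j)
    {v w : ι → ℝ} (hv : ∀ i, v i ≤ w i) (i : ι) : (M *ᵥ v) i ≤ (M *ᵥ w) i :=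
  Finset.sum_le_sum fun j _ => mul_le_mul_of_nonneg_left (hv j) (hM i j)

lemma sum_padCoeff {n N : ℕ} (hn : n ≤ N) (a : Fin n → ℝ) (f : ℕ → ℝ) :
    ∑ i ∈ Finset.range N, padCoeff a i * f i = ∑ i : Fin n, a i * f i := by
  have : ∑ i : Fin n, a i * f i = ∑ i : Fin n, padCoeff a i * f i :=
    Finset.sum_congr rfl fun i _ => by simp [padCoeff]
  rw [this, Fin.sum_univ_eq_sum_range (fun i => padCoeff a i * f i)]
  refine (Finset.sum_subset (Finset.range_mono hn) fun i _ hi => ?_).symm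
  simp only [Finset.mem_range, not_lt] at hi
  simp [padCoeff, not_lt.mpr hi]

section Rows

variable (x : ℝ) (v : AGARCHIdx p q → ℝ)

lemma agarchMatrix_mulVec_inl_succ (k : ℕ) (hk : k + 1 < max q 1) :
    (agarchMatrix α β γ x *ᵥ v) (.inl ⟨k + 1, hk⟩) = v (.inl ⟨k, by omega⟩) := by
  rw [Matrix.mulVec, dotProduct, Fintype.sum_sum_type]
  simp only [agarchMatrix, Matrix.of_apply, zero_mul, Finset.sum_const_zero, add_zero, ite_mul,
    one_mul]
  rw [Finset.sum_eq_single (⟨k, by omega⟩ : Fin (max q 1))]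
  · simp
  · intro b _ hb
    rw [if_neg fun h => hb (Fin.ext h)]
  · simp

lemma agarchMatrix_mulVec_inr_zero (h0 : 0 < p - 1) :
    (agarchMatrix α β γ x *ᵥ v) (.inr ⟨0, h0⟩) = asymSq γ x * v (idxZero p q) := by
  rw [Matrix.mulVec, dotProduct, Fintype.sum_sum_type]
  simp only [agarchMatrix, Matrix.of_apply, zero_mul, Finset.sum_const_zero, add_zero, ite_mul]
  rw [Finset.sum_eq_single (⟨0, by omega⟩ : Fin (max q 1))]
  · simp
  · intro b _ hb
    rw [if_neg fun h => hb (Fin.ext h)]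
  · simp

lemma agarchMatrix_mulVec_inr_succ (k : ℕ) (hk : k + 1 < p - 1) :
    (agarchMatrix α β γ x *ᵥ v) (.inr ⟨k + 1, hk⟩) = v (.inr ⟨k, by omega⟩) := by
  rw [Matrix.mulVec, dotProduct, Fintype.sum_sum_type]
  simp only [agarchMatrix, Matrix.of_apply, zero_mul, Finset.sum_const_zero, zero_add, ite_mul,
    one_mul]
  rw [Finset.sum_eq_single (⟨k, by omega⟩ : Fin (p - 1))]
  · simp
  · intro b _ hb
    rw [if_neg fun h => hb (Fin.ext h)]
  · simp

/-- The lag-one term (|X| - γ X)² is not a coordinate of the state; the corner entry produces it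
from the current squared volatility, which is the role of `h0`. Reading the coordinates as sequences
lets the zero padding absorb the cases p = 0 and q = 0. -/
lemma agarchMatrix_mulVec_inl_zero (f g : ℕ → ℝ) (hf : ∀ j : Fin (max q 1), v (.inl j) = f j)
    (hg : ∀ i : Fin (p - 1), v (.inr i) = g (i + 1)) (h0 : g 0 = asymSq γ x * f 0) :
    (agarchMatrix α β γ x *ᵥ v) (idxZero p q) =
      ∑ i : Fin p, α i * g i + ∑ j : Fin q, β j * f j := by
  rw [← sum_padCoeff (show p ≤ p - 1 + 1 by omega), ← sum_padCoeff (le_max_left q 1),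
    Finset.sum_range_succ', Matrix.mulVec, dotProduct, Fintype.sum_sum_type]
  simp only [agarchMatrix, Matrix.of_apply, add_mul, Finset.sum_add_distrib, hf, hg, ite_mul,
    zero_mul]
  rw [Fin.sum_univ_eq_sum_range (fun j => padCoeff β j * f j),
    Fin.sum_univ_eq_sum_range (fun i => padCoeff α (i + 1) * g (i + 1)),
    Finset.sum_eq_single (⟨0, by omega⟩ : Fin (max q 1))]
  · simp only [↓reduceIte, h0]
    ring
  · intro b _ hb
    rw [if_neg fun h => hb (Fin.ext h)]
  · simp

end Rows

/-- The state vector formed from a path of squared volatilities and a path of the noise. -/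
def pathState (p q : ℕ) (γ : ℝ) (h z : ℤ → ℝ) (t : ℤ) : AGARCHIdx p q → ℝ
  | .inl j => h (t - (j : ℕ))
  | .inr i => asymSq γ (z (t - ((i : ℕ) + 1))) * h (t - ((i : ℕ) + 1))

/-- The right-hand side of the volatility equation, in terms of the squared volatilities. -/
def volRec (α₀ : ℝ) (h : ℤ → ℝ) (t : ℤ) : ℝ :=
  α₀ + ∑ i : Fin p, α i * (asymSq γ (z (t - ((i : ℕ) + 1))) * h (t - ((i : ℕ) + 1)))
    + ∑ j : Fin q, β j * h (t - ((j : ℕ) + 1))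

variable (h : ℤ → ℝ) (α₀ : ℝ)

/-- Here `h` is an arbitrary path. This one identity serves both directions: from the volatility
equation to the vector recursion and back. -/
lemma pathState_recursion_zero (t : ℤ) :
    (agarchMatrix α β γ (z (t - 1)) *ᵥ pathState p q γ h z (t - 1) + agarchVec p q α₀)
      (idxZero p q) = volRec α β γ z α₀ h t := by
  rw [Pi.add_apply, agarchMatrix_mulVec_inl_zero α β γ _ _ (fun j => h (t - ((j : ℤ) + 1)))
    (fun i => asymSq γ (z (t - ((i : ℤ) + 1))) * h (t - ((i : ℤ) + 1)))]
  · simp only [agarchVec, volRec, ↓reduceIte]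
    ring
  · intro j
    simp only [pathState]
    congr 1
    ring
  · intro i
    simp only [pathState]
    rw [show t - 1 - (((i : ℕ) : ℤ) + 1) = t - (((i : ℕ) + 1 : ℕ) + 1 : ℤ) by push_cast; ring]
  · simp

lemma pathState_recursion (hh : ∀ t, h t = volRec α β γ z α₀ h t) (t : ℤ) :
    pathState p q γ h z t =
      agarchMatrix α β γ (z (t - 1)) *ᵥ pathState p q γ h z (t - 1) + agarchVec p q α₀ := by
  ext i
  rcases i with ⟨_ | k, hk⟩ | ⟨_ | k, hk⟩
  · rw [pathState_recursion_zero, ← hh]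
    simp [pathState]
  · rw [Pi.add_apply, agarchMatrix_mulVec_inl_succ]
    simp only [pathState, agarchVec, Nat.add_eq_zero_iff, one_ne_zero, and_false, ↓reduceIte,
      add_zero]
    congr 1
    push_cast
    ring
  · rw [Pi.add_apply, agarchMatrix_mulVec_inr_zero]
    simp [pathState, agarchVec]
  · rw [Pi.add_apply, agarchMatrix_mulVec_inr_succ]
    simp only [pathState, agarchVec, add_zero]
    rw [show t - (((k + 1 : ℕ) : ℤ) + 1) = t - 1 - ((k : ℤ) + 1) by push_cast; ring]

/-- A solution of the vector recursion is formed from its first coordinates. -/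
lemma eq_pathState_of_recursion (Y : ℤ → AGARCHIdx p q → ℝ)
    (hY : ∀ t, Y t = agarchMatrix α β γ (z (t - 1)) *ᵥ Y (t - 1) + agarchVec p q α₀) (t : ℤ) :
    Y t = pathState p q γ (fun s => Y s (idxZero p q)) z t := by
  have h1 : ∀ (k : ℕ) (hk : k < max q 1) (t : ℤ),
      Y t (.inl ⟨k, hk⟩) = Y (t - (k : ℤ)) (idxZero p q) := by
    intro k
    induction k with
    | zero => intro hk t; simp
    | succ k ih =>
      intro hk t
      rw [hY t, Pi.add_apply, agarchMatrix_mulVec_inl_succ, ih]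
      simp only [agarchVec, Nat.add_eq_zero_iff, one_ne_zero, and_false, ↓reduceIte, add_zero]
      congr 1
      push_cast
      ring
  have h2 : ∀ (k : ℕ) (hk : k < p - 1) (t : ℤ), Y t (.inr ⟨k, hk⟩) =
      asymSq γ (z (t - ((k : ℤ) + 1))) * Y (t - ((k : ℤ) + 1)) (idxZero p q) := by
    intro k
    induction k with
    | zero =>
      intro hk t
      rw [hY t, Pi.add_apply, agarchMatrix_mulVec_inr_zero]
      simp [agarchVec]
    | succ k ih =>
      intro hk t
      rw [hY t, Pi.add_apply, agarchMatrix_mulVec_inr_succ, ih]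
      simp only [agarchVec, add_zero]
      rw [show t - (((k + 1 : ℕ) : ℤ) + 1) = t - 1 - ((k : ℤ) + 1) by push_cast; ring]
  ext i
  rcases i with ⟨k, hk⟩ | ⟨k, hk⟩
  · rw [h1]; rfl
  · rw [h2]; rfl

lemma volRec_of_recursion (Y : ℤ → AGARCHIdx p q → ℝ)
    (hY : ∀ t, Y t = agarchMatrix α β γ (z (t - 1)) *ᵥ Y (t - 1) + agarchVec p q α₀) (t : ℤ) :
    Y t (idxZero p q) = volRec α β γ z α₀ (fun s => Y s (idxZero p q)) t := by
  rw [← pathState_recursion_zero, ← eq_pathState_of_recursion α β γ z α₀ Y hY (t - 1), ← hY]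

/-- All rows but the first only store or shift, so a coordinate at depth k recalls the first
coordinate k steps earlier. This lemma and the next reduce estimates of whole vectors to their first
coordinates. -/
lemma pathProd_mulVec_inl (v : AGARCHIdx p q → ℝ) (n k : ℕ) (hk : k < max q 1) (t : ℤ) :
    (pathProd α β γ z t (n + k) *ᵥ v) (.inl ⟨k, hk⟩) =
      (pathProd α β γ z (t - k) n *ᵥ v) (idxZero p q) := by
  induction k generalizing t with
  | zero => simp
  | succ k ih =>
    rw [← add_assoc, pathProd_succ, ← Matrix.mulVec_mulVec, agarchMatrix_mulVec_inl_succ, ih,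
      show t - 1 - (k : ℤ) = t - ((k + 1 : ℕ) : ℤ) by push_cast; ring]

lemma pathProd_mulVec_inr (v : AGARCHIdx p q → ℝ) (n k : ℕ) (hk : k < p - 1) (t : ℤ) :
    (pathProd α β γ z t (n + k + 1) *ᵥ v) (.inr ⟨k, hk⟩) = asymSq γ (z (t - ((k : ℤ) + 1))) *
      (pathProd α β γ z (t - ((k : ℤ) + 1)) n *ᵥ v) (idxZero p q) := by
  induction k generalizing t with
  | zero => rw [pathProd_succ, ← Matrix.mulVec_mulVec, agarchMatrix_mulVec_inr_zero]; simp
  | succ k ih =>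
    rw [pathProd_succ, ← Matrix.mulVec_mulVec, agarchMatrix_mulVec_inr_succ, ← add_assoc, ih]
    rw [show t - (((k + 1 : ℕ) : ℤ) + 1) = t - 1 - ((k : ℤ) + 1) by push_cast; ring]

/-- The unrolled recursion with its exact remainder. It drives the contraction estimate, the
identification of stationary solutions with the series, and the bound on partial sums along a
constant path. -/
lemma eq_sum_add_pathProd_mulVec (Y : ℤ → AGARCHIdx p q → ℝ)
    (hY : ∀ t, Y t = agarchMatrix α β γ (z (t - 1)) *ᵥ Y (t - 1) + agarchVec p q α₀) (t : ℤ)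
    (n : ℕ) :
    Y t = ∑ k ∈ Finset.range n, pathProd α β γ z t k *ᵥ agarchVec p q α₀ +
      pathProd α β γ z t n *ᵥ Y (t - n) := by
  induction n with
  | zero => simp
  | succ n ih =>
    rw [ih, Finset.sum_range_succ, pathProd_add α β γ z t n 1, ← Matrix.mulVec_mulVec,
      hY (t - n), Matrix.mulVec_add, pathProd_succ, pathProd_zero, mul_one]
    push_cast
    rw [show t - ((n : ℤ) + 1) = t - n - 1 by ring]
    abel

end Path

/-! ### Operator norms and growth of the matrix products -/

section OpNorm

variable {ι : Type*} [Fintype ι] [DecidableEq ι]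

/-- The operator norm of a real matrix with respect to the Euclidean norm. -/
def opNorm (M : Matrix ι ι ℝ) : ℝ := ‖Matrix.toEuclideanCLM (𝕜 := ℝ) M‖

lemma opNorm_nonneg (M : Matrix ι ι ℝ) : 0 ≤ opNorm M := norm_nonneg _

lemma opNorm_mul_le (M N : Matrix ι ι ℝ) : opNorm (M * N) ≤ opNorm M * opNorm N := by
  unfold opNorm
  rw [map_mul]
  exact norm_mul_le _ _

lemma abs_apply_le_opNorm (M : Matrix ι ι ℝ) (i j : ι) : |M i j| ≤ opNorm M := by
  have h1 := (Matrix.toEuclideanCLM (𝕜 := ℝ) M).le_opNorm (EuclideanSpace.single j (1 : ℝ))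
  rw [PiLp.norm_single, norm_one, mul_one] at h1
  have h2 := PiLp.norm_apply_le (Matrix.toEuclideanCLM (𝕜 := ℝ) M (EuclideanSpace.single j 1)) i
  have h3 : (Matrix.toEuclideanCLM (𝕜 := ℝ) M (EuclideanSpace.single j 1)) i = M i j := by
    simp [Matrix.ofLp_toEuclideanCLM]
  rw [h3, Real.norm_eq_abs] at h2
  exact h2.trans h1

lemma exists_opNorm_le (ι : Type*) [Fintype ι] [DecidableEq ι] [Nonempty ι] : ∃ C : ℝ, 0 < C ∧
    ∀ (M : Matrix ι ι ℝ) (r : ℝ), (∀ i j, |M i j| ≤ r) → opNorm M ≤ C * r := by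
  refine ⟨(∑ i : ι, ∑ j : ι, opNorm (Matrix.single i j (1 : ℝ))) + 1, ?_, fun M r hM => ?_⟩
  · have : 0 ≤ ∑ i : ι, ∑ j : ι, opNorm (Matrix.single i j (1 : ℝ)) :=
      Finset.sum_nonneg fun i _ => Finset.sum_nonneg fun j _ => opNorm_nonneg _
    positivity
  · have hs : ∀ i j, opNorm (Matrix.single i j (M i j)) ≤ opNorm (Matrix.single i j (1 : ℝ)) * r := by
      intro i j
      have : Matrix.single i j (M i j) = M i j • Matrix.single i j (1 : ℝ) := by simp
      unfold opNorm
      rw [this, map_smul, norm_smul, Real.norm_eq_abs, mul_comm]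
      gcongr
      exact hM i j
    obtain ⟨i0⟩ := ‹Nonempty ι›
    have hr : 0 ≤ r := (abs_nonneg _).trans (hM i0 i0)
    have hMs : M = ∑ i, ∑ j, Matrix.single i j (M i j) := Matrix.matrix_eq_sum_single M
    calc opNorm M ≤ ∑ i, ∑ j, opNorm (Matrix.single i j (M i j)) := by
          conv_lhs => rw [hMs]
          unfold opNorm
          rw [map_sum]
          refine (norm_sum_le _ _).trans (Finset.sum_le_sum fun i _ => ?_)
          rw [map_sum]
          exact norm_sum_le _ _
      _ ≤ ∑ i, ∑ j, opNorm (Matrix.single i j (1 : ℝ)) * r :=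
          Finset.sum_le_sum fun i _ => Finset.sum_le_sum fun j _ => hs i j
      _ ≤ _ := by
          simp only [← Finset.sum_mul, add_mul]
          linarith

end OpNorm

/-! ### Exponential bounds for the entries of the products -/

section Growth

variable {p q : ℕ} (α : Fin p → ℝ) (β : Fin q → ℝ) (γ : ℝ)

@[simp] lemma asymSq_zero : asymSq γ 0 = 0 := by simp [asymSq]

variable {γ} in
lemma asymSq_le (hγ : |γ| ≤ 1) (x : ℝ) : asymSq γ x ≤ 4 * x ^ 2 := by
  have h1 : |(|x| - γ * x)| ≤ 2 * |x| := by
    calc |(|x| - γ * x)| ≤ |(|x|)| + |γ * x| := abs_sub _ _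
      _ ≤ |x| + 1 * |x| := by
        rw [abs_abs, abs_mul]
        gcongr
      _ = _ := by ring
  have h2 := pow_le_pow_left₀ (abs_nonneg _) h1 2
  rw [sq_abs, mul_pow, sq_abs] at h2
  unfold asymSq
  linarith

lemma measurable_asymSq : Measurable (asymSq γ) := by
  unfold asymSq
  fun_prop

/-- The entries of the matrix are affine functions of `(|z| - γ z)²` with nonnegative slope. -/
lemma exists_agarchMatrix_eq_add_mul (hα : ∀ i, 0 ≤ α i) :
    ∃ b : AGARCHIdx p q → AGARCHIdx p q → ℝ, (∀ i j, 0 ≤ b i j) ∧ ∀ x i j,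
      agarchMatrix α β γ x i j = agarchMatrix α β γ 0 i j + b i j * asymSq γ x := by
  have : ∀ i j : AGARCHIdx p q, ∃ b : ℝ, 0 ≤ b ∧ ∀ x,
      agarchMatrix α β γ x i j = agarchMatrix α β γ 0 i j + b * asymSq γ x := by
    intro i j
    rcases i with ⟨_ | k, hk⟩ | ⟨_ | k, hk⟩ <;> rcases j with j | j <;>
      simp only [agarchMatrix, Matrix.of_apply, asymSq_zero, mul_zero, ite_self, zero_add]
    · refine ⟨if (j : ℕ) = 0 then padCoeff α 0 else 0, ?_, fun x => ?_⟩
      · split_ifs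
        exacts [padCoeff_nonneg hα 0, le_rfl]
      · split_ifs <;> ring
    · exact ⟨0, le_rfl, by simp⟩
    · exact ⟨0, le_rfl, by simp⟩
    · exact ⟨0, le_rfl, by simp⟩
    · refine ⟨if (j : ℕ) = 0 then 1 else 0, ?_, fun x => ?_⟩
      · split_ifs <;> norm_num
      · split_ifs <;> ring
    · exact ⟨0, le_rfl, by simp⟩
    · exact ⟨0, le_rfl, by simp⟩
    · exact ⟨0, le_rfl, by simp⟩
  choose b hb0 hb using this
  exact ⟨b, hb0, fun x i j => hb i j x⟩

variable {α β γ}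

/-- The entries grow at most quadratically in the noise. The exponential form makes the logarithm of
a product at most a sum of integrable terms c + |z|. -/
lemma exists_sum_agarchMatrix_le (hα : ∀ i, 0 ≤ α i) (hγ : |γ| ≤ 1) : ∃ c : ℝ, 0 ≤ c ∧
    ∀ x, ∑ i, ∑ j, |agarchMatrix α β γ x i j| ≤ Real.exp (c + |x|) := by
  obtain ⟨b, hb0, hb⟩ := exists_agarchMatrix_eq_add_mul α β γ hα
  set K : ℝ := ∑ i, ∑ j, (|agarchMatrix α β γ 0 i j| + 8 * b i j) with hK
  have hK0 : 0 ≤ K := Finset.sum_nonneg fun i _ => Finset.sum_nonneg fun j _ => by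
    have := hb0 i j
    positivity
  refine ⟨K, hK0, fun x => ?_⟩
  -- The factor 8 turns `asymSq γ x ≤ 4 x²` into the quadratic term x²/2 of the exponential.
  have hx : 1 + asymSq γ x / 8 ≤ Real.exp |x| := by
    have h1 := asymSq_le hγ x
    have h2 := Real.quadratic_le_exp_of_nonneg (abs_nonneg x)
    rw [sq_abs] at h2
    have := abs_nonneg x
    linarith
  have h8 := asymSq_nonneg γ x
  calc ∑ i, ∑ j, |agarchMatrix α β γ x i j|
      ≤ ∑ i, ∑ j, (|agarchMatrix α β γ 0 i j| + 8 * b i j) * Real.exp |x| := by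
        refine Finset.sum_le_sum fun i _ => Finset.sum_le_sum fun j _ => ?_
        rw [hb]
        have h3 := hb0 i j
        calc _ ≤ |agarchMatrix α β γ 0 i j| + |b i j * asymSq γ x| := abs_add_le _ _
          _ ≤ (|agarchMatrix α β γ 0 i j| + 8 * b i j) * (1 + asymSq γ x / 8) := by
            rw [abs_of_nonneg (mul_nonneg h3 h8)]
            have := mul_nonneg (abs_nonneg (agarchMatrix α β γ 0 i j)) h8
            nlinarith
          _ ≤ _ := by gcongr
    _ = K * Real.exp |x| := by simp only [hK, Finset.sum_mul]
    _ ≤ Real.exp K * Real.exp |x| := by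
        gcongr
        linarith [Real.add_one_le_exp K]
    _ = _ := (Real.exp_add _ _).symm

variable {z : ℤ → ℝ} {c : ℝ}

lemma abs_pathProd_le (hc : ∀ x, ∑ i, ∑ j, |agarchMatrix α β γ x i j| ≤ Real.exp (c + |x|))
    (t : ℤ) (n : ℕ) (i j : AGARCHIdx p q) :
    |pathProd α β γ z t n i j| ≤
      Real.exp (∑ l ∈ Finset.range n, (c + |z (t - ((l : ℤ) + 1))|)) := by
  induction n generalizing t i with
  | zero =>
    rw [pathProd_zero, Matrix.one_apply]
    split_ifs <;> simp
  | succ n ih =>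
    rw [pathProd_succ, Matrix.mul_apply, Finset.sum_range_succ', add_comm, Real.exp_add]
    refine (Finset.abs_sum_le_sum_abs _ _).trans ?_
    calc ∑ l, |agarchMatrix α β γ (z (t - 1)) i l * pathProd α β γ z (t - 1) n l j|
        ≤ ∑ l, |agarchMatrix α β γ (z (t - 1)) i l| *
          Real.exp (∑ l ∈ Finset.range n, (c + |z (t - 1 - ((l : ℤ) + 1))|)) := by
          refine Finset.sum_le_sum fun l _ => ?_
          rw [abs_mul]
          gcongr
          exact ih _ _
      _ = (∑ l, |agarchMatrix α β γ (z (t - 1)) i l|) * _ := by rw [Finset.sum_mul]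
      _ ≤ _ := by
          refine mul_le_mul ?_ (le_of_eq ?_) (Real.exp_nonneg _) (Real.exp_nonneg _)
          · refine le_trans ?_ ((hc (z (t - 1))).trans (by simp))
            exact Finset.single_le_sum
              (f := fun i => ∑ j, |agarchMatrix α β γ (z (t - 1)) i j|)
              (fun i _ => Finset.sum_nonneg fun j _ => abs_nonneg _) (Finset.mem_univ i)
          · congr 1
            refine Finset.sum_congr rfl fun l _ => ?_
            rw [show t - 1 - ((l : ℤ) + 1) = t - (((l + 1 : ℕ) : ℤ) + 1) by push_cast; ring]

end Growth

/-! ### Contraction of the products along a solution bounded below by α₀ -/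

section Contraction

variable {p q : ℕ} {α : Fin p → ℝ} {β : Fin q → ℝ} {γ : ℝ} {z h : ℤ → ℝ} {α₀ c : ℝ}

/-- The number of steps after which the recursion forgets all coordinates of the state. -/
def memLength (p q : ℕ) : ℕ := max q 1 + p

lemma memLength_pos : 0 < memLength p q := by unfold memLength; omega

/-- The proportion of the state at time `t` that is created in the preceding steps. -/
def freshRatio (p q : ℕ) (α₀ : ℝ) (h : ℤ → ℝ) (t : ℤ) : ℝ :=
  α₀ / ∑ k ∈ Finset.range (memLength p q), h (t - k)

lemma freshRatio_pos (hα₀ : 0 < α₀) (hh : ∀ t, α₀ ≤ h t) (t : ℤ) :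
    0 < freshRatio p q α₀ h t := by
  refine div_pos hα₀ (Finset.sum_pos (fun k _ => hα₀.trans_le (hh _)) ?_)
  exact Finset.nonempty_range_iff.mpr memLength_pos.ne'

lemma freshRatio_mul_le (hα₀ : 0 < α₀) (hh : ∀ t, α₀ ≤ h t) (t : ℤ) {k : ℕ}
    (hk : k < memLength p q) : freshRatio p q α₀ h t * h (t - k) ≤ α₀ := by
  have h1 : h (t - k) ≤ ∑ k ∈ Finset.range (memLength p q), h (t - k) :=
    Finset.single_le_sum (f := fun k : ℕ => h (t - k)) (fun k _ => hα₀.le.trans (hh _))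
      (Finset.mem_range.mpr hk)
  have h2 : 0 < h (t - k) := hα₀.trans_le (hh _)
  rw [freshRatio, div_mul_eq_mul_div, div_le_iff₀ (h2.trans_le h1)]
  gcongr

lemma freshRatio_le_one (hα₀ : 0 < α₀) (hh : ∀ t, α₀ ≤ h t) (t : ℤ) :
    freshRatio p q α₀ h t ≤ 1 := by
  have h1 := freshRatio_mul_le hα₀ hh t (memLength_pos (p := p) (q := q))
  have h2 := freshRatio_pos (p := p) (q := q) hα₀ hh t
  have h3 := hh (t - (0 : ℕ))
  by_contra hlt
  push Not at hlt
  nlinarith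

lemma pathState_nonneg (hh : ∀ t, 0 ≤ h t) (t : ℤ) (i : AGARCHIdx p q) :
    0 ≤ pathState p q γ h z t i := by
  rcases i with i | i
  · exact hh _
  · exact mul_nonneg (asymSq_nonneg _ _) (hh _)

lemma agarchVec_nonneg (hα₀ : 0 ≤ α₀) (i : AGARCHIdx p q) : 0 ≤ agarchVec p q α₀ i := by
  rcases i with i | i <;> simp only [agarchVec]
  · split_ifs
    exacts [hα₀, le_rfl]
  · rfl

/-- A nonnegative vector, transported over many steps, is dominated by any state. -/
lemma pathProd_mulVec_le_mul_pathState (hα₀ : 0 < α₀) (hh : ∀ t, α₀ ≤ h t) (t : ℤ)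
    (v : AGARCHIdx p q → ℝ) {r : ℝ} (hr0 : 0 ≤ r)
    (hr : ∀ n k : ℕ, n + k = memLength p q →
      (pathProd α β γ z (t - k) n *ᵥ v) (idxZero p q) ≤ r) (i : AGARCHIdx p q) :
    (pathProd α β γ z t (memLength p q) *ᵥ v) i ≤ r / α₀ * pathState p q γ h z t i := by
  have hmul : ∀ s, r ≤ r / α₀ * h s := fun s => by
    rw [div_mul_eq_mul_div, le_div_iff₀ hα₀]
    exact mul_le_mul_of_nonneg_left (hh s) hr0
  rcases i with ⟨k, hk⟩ | ⟨k, hk⟩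
  · obtain ⟨n, hn⟩ : ∃ n, n + k = memLength p q := ⟨memLength p q - k, by unfold memLength; omega⟩
    have h1 := hr n k hn
    rw [← hn, pathProd_mulVec_inl]
    exact h1.trans (hmul _)
  · obtain ⟨n, hn⟩ : ∃ n, n + (k + 1) = memLength p q :=
      ⟨memLength p q - (k + 1), by unfold memLength; omega⟩
    have h1 := hr n (k + 1) hn
    rw [← hn, ← add_assoc, pathProd_mulVec_inr]
    push_cast at h1
    calc _ ≤ asymSq γ (z (t - ((k : ℤ) + 1))) * (r / α₀ * h (t - ((k : ℤ) + 1))) := by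
          gcongr
          · exact asymSq_nonneg _ _
          · exact h1.trans (hmul _)
      _ = _ := by simp only [pathState]; ring

/-- A coordinate of the state is some h_{t-k}, possibly times (|z| - γ z)². The k-th term of the
series contributes α₀ with the same factor in that coordinate, and the ratio is chosen so that its
product with h_{t-k} is at most α₀. -/
lemma agarchVec_sum_ge (hα₀ : 0 < α₀) (hα : ∀ i, 0 ≤ α i) (hβ : ∀ j, 0 ≤ β j)
    (hh : ∀ t, α₀ ≤ h t) (t : ℤ) (i : AGARCHIdx p q) :
    freshRatio p q α₀ h t * pathState p q γ h z t i ≤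
      (∑ k ∈ Finset.range (memLength p q), pathProd α β γ z t k *ᵥ agarchVec p q α₀) i := by
  have hnn : ∀ k, 0 ≤ (pathProd α β γ z t k *ᵥ agarchVec p q α₀) i := fun k =>
    mulVec_nonneg_of_nonneg (pathProd_nonneg γ z hα hβ t k) (agarchVec_nonneg hα₀.le) i
  rw [Finset.sum_apply]
  have key : ∀ k < memLength p q, (pathProd α β γ z t k *ᵥ agarchVec p q α₀) i ≤
      ∑ k ∈ Finset.range (memLength p q), (pathProd α β γ z t k *ᵥ agarchVec p q α₀) i :=
    fun k hk => Finset.single_le_sum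
      (f := fun k => (pathProd α β γ z t k *ᵥ agarchVec p q α₀) i) (fun k _ => hnn k)
      (Finset.mem_range.mpr hk)
  rcases i with ⟨k, hk⟩ | ⟨k, hk⟩
  · have hk' : k < memLength p q := by unfold memLength; omega
    refine le_trans ?_ (key k hk')
    have h1 := pathProd_mulVec_inl α β γ z (agarchVec p q α₀) 0 k hk t
    rw [zero_add, pathProd_zero, Matrix.one_mulVec] at h1
    rw [h1]
    simpa [agarchVec, pathState] using freshRatio_mul_le hα₀ hh t hk'
  · have hk' : k + 1 < memLength p q := by unfold memLength; omega
    refine le_trans ?_ (key (k + 1) hk')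
    have h1 := pathProd_mulVec_inr α β γ z (agarchVec p q α₀) 0 k hk t
    rw [zero_add, pathProd_zero, Matrix.one_mulVec] at h1
    rw [h1]
    have h2 := freshRatio_mul_le hα₀ hh t hk'
    have h3 := asymSq_nonneg γ (z (t - ((k : ℤ) + 1)))
    push_cast at h2
    simp only [agarchVec, pathState, ↓reduceIte]
    nlinarith

variable (hα₀ : 0 < α₀) (hα : ∀ i, 0 ≤ α i) (hβ : ∀ j, 0 ≤ β j) (hh : ∀ t, α₀ ≤ h t)
  (hrec : ∀ t, h t = volRec α β γ z α₀ h t)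
include hα₀ hα hβ hh hrec

/-- State equals fresh part plus transported old part over one block; the fresh part takes at least
its proportion in every coordinate. -/
lemma pathProd_mulVec_pathState_le_step (t : ℤ) (i : AGARCHIdx p q) :
    (pathProd α β γ z t (memLength p q) *ᵥ pathState p q γ h z (t - memLength p q)) i ≤
      (1 - freshRatio p q α₀ h t) * pathState p q γ h z t i := by
  have h1 := congrFun (eq_sum_add_pathProd_mulVec α β γ z α₀ (pathState p q γ h z)
    (pathState_recursion α β γ z h α₀ hrec) t (memLength p q)) i
  have h2 := agarchVec_sum_ge (γ := γ) (z := z) hα₀ hα hβ hh t i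
  rw [Pi.add_apply] at h1
  linarith

/-- The one-block contraction iterates because nonnegative matrices preserve coordinatewise
inequalities; 1 - x ≤ exp(-x) turns the product of factors into an exponential of a sum. -/
lemma pathProd_mulVec_pathState_le (t : ℤ) (n : ℕ) (i : AGARCHIdx p q) :
    (pathProd α β γ z t (n * memLength p q) *ᵥ
      pathState p q γ h z (t - (n * memLength p q : ℕ))) i ≤
      Real.exp (-∑ j ∈ Finset.range n, freshRatio p q α₀ h (t - (j * memLength p q : ℕ))) *
        pathState p q γ h z t i := by
  induction n generalizing t i with
  | zero => simp
  | succ n ih =>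
    set D := memLength p q with hD
    rw [Finset.sum_range_succ', neg_add, Real.exp_add, show (n + 1) * D = D + n * D by ring,
      pathProd_add, ← Matrix.mulVec_mulVec]
    set E := Real.exp (-∑ j ∈ Finset.range n, freshRatio p q α₀ h (t - ((j + 1) * D : ℕ))) with hE
    have h1 : ∀ i, (pathProd α β γ z (t - D) (n * D) *ᵥ
        pathState p q γ h z (t - (D + n * D : ℕ))) i ≤ (E • pathState p q γ h z (t - D)) i := by
      intro i
      have := ih (t - D) i
      rw [show t - (D : ℤ) - ((n * D : ℕ) : ℤ) = t - ((D + n * D : ℕ) : ℤ) by push_cast; ring]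
        at this
      refine this.trans (le_of_eq ?_)
      rw [Pi.smul_apply, smul_eq_mul, hE]
      congr 3
      refine Finset.sum_congr rfl fun j _ => ?_
      congr 1
      push_cast
      ring
    refine (mulVec_mono_of_nonneg (pathProd_nonneg γ z hα hβ t D) h1 i).trans ?_
    rw [Matrix.mulVec_smul, Pi.smul_apply, smul_eq_mul, mul_assoc]
    refine mul_le_mul_of_nonneg_left ?_ (Real.exp_nonneg _)
    refine (pathProd_mulVec_pathState_le_step hα₀ hα hβ hh hrec t i).trans ?_
    refine mul_le_mul_of_nonneg_right ?_ (pathState_nonneg (fun t => hα₀.le.trans (hh t)) t i)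
    have := Real.add_one_le_exp (-freshRatio p q α₀ h t)
    simp only [zero_mul, Nat.cast_zero, sub_zero]
    linarith

/-- Entries of the products are small if many of the ratios of new mass are large. -/
lemma pathProd_le_of_recursion (hc0 : 0 ≤ c)
    (hc : ∀ x, ∑ i, ∑ j, |agarchMatrix α β γ x i j| ≤ Real.exp (c + |x|)) (t : ℤ) (n : ℕ)
    (i j : AGARCHIdx p q) :
    |pathProd α β γ z t (n * memLength p q + memLength p q) i j| ≤
      Real.exp (∑ l ∈ Finset.range (memLength p q),
        (c + |z (t - (n * memLength p q : ℕ) - ((l : ℤ) + 1))|)) / α₀ *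
      Real.exp (-∑ j ∈ Finset.range n, freshRatio p q α₀ h (t - (j * memLength p q : ℕ))) *
        ∑ i, pathState p q γ h z t i := by
  set D := memLength p q with hD
  set s := t - (n * D : ℕ) with hs
  set κ := Real.exp (∑ l ∈ Finset.range D, (c + |z (s - ((l : ℤ) + 1))|)) with hκ
  -- After the oldest block a basis vector lies below a multiple of the state, and so inherits the
  -- contraction over the n later blocks.
  have hcol : ∀ i, (pathProd α β γ z s D *ᵥ Pi.single j 1) i ≤
      ((κ / α₀) • pathState p q γ h z s) i := by
    intro i
    refine pathProd_mulVec_le_mul_pathState hα₀ hh s _ (Real.exp_nonneg _) ?_ i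
    intro m k hmk
    rw [Matrix.mulVec_single_one]
    refine (le_abs_self _).trans ((abs_pathProd_le hc _ _ _ _).trans ?_)
    refine Real.exp_le_exp.mpr ?_
    rw [← hD] at hmk
    -- The m remaining factors account for the last m summands of the exponent in `κ`; the k
    -- discarded ones are nonnegative since 0 ≤ c.
    rw [← hmk, add_comm m k, Finset.sum_range_add]
    refine le_trans (le_of_eq ?_) (le_add_of_nonneg_left ?_)
    · refine Finset.sum_congr rfl fun l _ => ?_
      rw [show s - (k : ℤ) - ((l : ℤ) + 1) = s - (((k + l : ℕ) : ℤ) + 1) by push_cast; ring]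
    · exact Finset.sum_nonneg fun l _ => by positivity
  have hnn := pathState_nonneg (p := p) (q := q) (γ := γ) (z := z)
    (fun t => hα₀.le.trans (hh t)) t
  rw [abs_of_nonneg (pathProd_nonneg γ z hα hβ _ _ _ _), pathProd_add, ← hs]
  have h1 : (pathProd α β γ z t (n * D) * pathProd α β γ z s D) i j =
      (pathProd α β γ z t (n * D) *ᵥ (pathProd α β γ z s D *ᵥ Pi.single j 1)) i := by
    rw [Matrix.mulVec_mulVec, Matrix.mulVec_single_one]
    rfl
  rw [h1]
  refine (mulVec_mono_of_nonneg (pathProd_nonneg γ z hα hβ t _) hcol i).trans ?_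
  rw [Matrix.mulVec_smul, Pi.smul_apply, smul_eq_mul, mul_assoc]
  refine mul_le_mul_of_nonneg_left ?_ (by positivity)
  refine (pathProd_mulVec_pathState_le hα₀ hα hβ hh hrec t n i).trans ?_
  refine mul_le_mul_of_nonneg_left ?_ (Real.exp_nonneg _)
  exact Finset.single_le_sum (f := fun i => pathState p q γ h z t i) (fun i _ => hnn i)
    (Finset.mem_univ i)

end Contraction

/-! ### Independent and identically distributed noise -/

section Noise

variable {Ω : Type*} {Z : ℤ → Ω → ℝ}

/-- The σ-field generated by the noise at the times in `S`. -/
@[reducible] def noiseSigma (Z : ℤ → Ω → ℝ) (S : Set ℤ) : MeasurableSpace Ω :=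
  ⨆ k ∈ S, MeasurableSpace.comap (Z k) inferInstance

lemma measurable_noiseSigma {S : Set ℤ} {k : ℤ} (hk : k ∈ S) : Measurable[noiseSigma Z S] (Z k) :=
  measurable_iff_comap_le.mpr
    (le_iSup₂ (f := fun k (_ : k ∈ S) => MeasurableSpace.comap (Z k) inferInstance) k hk)

variable [mΩ : MeasurableSpace Ω] {P : Measure Ω}

lemma noiseSigma_le (hZ_meas : ∀ t, Measurable (Z t)) (S : Set ℤ) : noiseSigma Z S ≤ mΩ :=
  iSup₂_le fun k _ => (hZ_meas k).comap_le

lemma indep_noiseSigma (hZ_meas : ∀ t, Measurable (Z t)) (hZ_indep : iIndepFun Z P)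
    {S T : Set ℤ} (hST : Disjoint S T) : Indep (noiseSigma Z S) (noiseSigma Z T) P :=
  indep_iSup_of_disjoint (fun k => (hZ_meas k).comap_le) hZ_indep.iIndep hST

lemma lintegral_mul_of_noiseSigma (hZ_meas : ∀ t, Measurable (Z t)) (hZ_indep : iIndepFun Z P)
    {S T : Set ℤ} (hST : Disjoint S T) {f g : Ω → ℝ≥0∞} (hf : Measurable[noiseSigma Z S] f)
    (hg : Measurable[noiseSigma Z T] g) :
    ∫⁻ ω, f ω * g ω ∂P = (∫⁻ ω, f ω ∂P) * ∫⁻ ω, g ω ∂P :=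
  lintegral_mul_eq_lintegral_mul_lintegral_of_independent_measurableSpace
    (noiseSigma_le hZ_meas S) (noiseSigma_le hZ_meas T) (indep_noiseSigma hZ_meas hZ_indep hST)
    hf hg

lemma measurable_path (hZ_meas : ∀ t, Measurable (Z t)) : Measurable fun ω t => Z t ω :=
  measurable_pi_iff.mpr hZ_meas

lemma map_path_shift (hZ_meas : ∀ t, Measurable (Z t)) (hZ_indep : iIndepFun Z P)
    (hZ_ident : ∀ t, IdentDistrib (Z t) (Z 0) P P) (h : ℤ) :
    P.map (fun ω t => Z (t + h) ω) = P.map (fun ω t => Z t ω) := by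
  have h1 : iIndepFun (fun t => Z (t + h)) P :=
    hZ_indep.precomp (g := fun t => t + h) (add_left_injective h)
  rw [h1.map_fun_eq_infinitePi_map fun t => hZ_meas _, hZ_indep.map_fun_eq_infinitePi_map hZ_meas]
  congr 1
  ext1 t
  rw [(hZ_ident (t + h)).map_eq, (hZ_ident t).map_eq]

lemma identDistrib_path_shift (hZ_meas : ∀ t, Measurable (Z t)) (hZ_indep : iIndepFun Z P)
    (hZ_ident : ∀ t, IdentDistrib (Z t) (Z 0) P P) (h : ℤ) :
    IdentDistrib (fun ω t => Z (t + h) ω) (fun ω t => Z t ω) P P :=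
  ⟨(measurable_pi_iff.mpr fun _ => hZ_meas _).aemeasurable, (measurable_path hZ_meas).aemeasurable,
    map_path_shift hZ_meas hZ_indep hZ_ident h⟩

lemma measurable_pathShift {E : Type*} [MeasurableSpace E] : Measurable (pathShift (E := E)) :=
  measurable_pi_iff.mpr fun t => measurable_pi_apply (t + 1)

lemma pathShift_iterate {E : Type*} (n : ℕ) (v : ℤ → E) :
    pathShift^[n] v = fun t => v (t + n) := by
  induction n generalizing v with
  | zero => simp
  | succ n ih =>
    rw [Function.iterate_succ_apply, ih]
    ext t
    simp only [pathShift]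
    congr 1
    push_cast
    ring

lemma exists_disjoint_add (I : Finset ℤ) :
    ∃ n : ℕ, Disjoint (I : Set ℤ) {k | k - n ∈ I} := by
  obtain ⟨a, ha⟩ := I.bddAbove
  obtain ⟨b, hb⟩ := I.bddBelow
  refine ⟨(a - b + 1).toNat, Set.disjoint_left.mpr fun k hk hk' => ?_⟩
  have h1 := ha hk
  have h2 := hb hk'
  omega

lemma isStationaryProcess_of_eq {E : Type*} [MeasurableSpace E] (hZ_meas : ∀ t, Measurable (Z t))
    (hZ_indep : iIndepFun Z P) (hZ_ident : ∀ t, IdentDistrib (Z t) (Z 0) P P)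
    {F : (ℤ → ℝ) → E} (hF : Measurable F) :
    IsStationaryProcess P fun t ω => F fun s => Z (s + t) ω := by
  intro h
  set Φ : (ℤ → ℝ) → ℤ → E := fun z t => F fun s => z (s + t) with hΦ
  have hΦm : Measurable Φ := measurable_pi_iff.mpr fun t =>
    hF.comp (measurable_pi_iff.mpr fun s => measurable_pi_apply (s + t))
  have h1 := (identDistrib_path_shift hZ_meas hZ_indep hZ_ident h).comp hΦm
  refine (congrArg₂ (fun f g => IdentDistrib f g P P) ?_ rfl).mp h1
  ext ω t
  simp only [hΦ, Function.comp]
  congr 1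
  ext s
  congr 1
  ring

variable [IsProbabilityMeasure P]

/-- A zero-one argument. An invariant set s is approximated by a cylinder u; a far shift of u
involves disjoint coordinates, so it is independent of u and still approximates s. In the limit ν(s)
= ν(s)². -/
lemma isErgodicProcess_of_iIndepFun (hZ_meas : ∀ t, Measurable (Z t)) (hZ_indep : iIndepFun Z P)
    (hZ_ident : ∀ t, IdentDistrib (Z t) (Z 0) P P) : IsErgodicProcess P Z := by
  have hm := measurable_path hZ_meas
  set ν := P.map (fun ω t => Z t ω) with hν
  have : IsProbabilityMeasure ν := Measure.isProbabilityMeasure_map hm.aemeasurable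
  have hmp : MeasurePreserving (pathShift (E := ℝ)) ν ν := by
    refine ⟨measurable_pathShift, ?_⟩
    rw [hν, Measure.map_map measurable_pathShift hm]
    exact map_path_shift hZ_meas hZ_indep hZ_ident 1
  refine ⟨hmp, ⟨fun s hs hinv => ?_⟩⟩
  have hinv' : ∀ n : ℕ, pathShift^[n] ⁻¹' s = s := by
    intro n
    induction n with
    | zero => rfl
    | succ n ih => rw [Function.iterate_succ, Set.preimage_comp, ih, hinv]
  have hdense : ν.MeasureDense (measurableCylinders fun _ : ℤ => ℝ) :=
    Measure.MeasureDense.of_generateFrom_isSetAlgebra_finite ν isSetAlgebra_measurableCylinders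
      generateFrom_measurableCylinders.symm
  have key : ∀ ε : ℝ, 0 < ε → |ν.real s - ν.real s ^ 2| ≤ 4 * ε := by
    intro ε hε
    obtain ⟨u, hu, hsu⟩ := hdense.approx s hs (measure_ne_top _ _) ε hε
    have hum := hdense.measurable u hu
    obtain ⟨I, S, hS, rfl⟩ := (mem_measurableCylinders u).mp hu
    set u : Set (ℤ → ℝ) := cylinder I S
    have hsu' : ν.real (symmDiff s u) ≤ ε := ENNReal.toReal_le_of_le_ofReal hε.le hsu.le
    obtain ⟨n, hn⟩ := exists_disjoint_add I
    have hmpn := hmp.iterate n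
    have hmix : ν (u ∩ pathShift^[n] ⁻¹' u) = ν u * ν u := by
      conv_rhs => enter [2]; rw [← hmpn.measure_preimage hum.nullMeasurableSet]
      rw [hν, Measure.map_apply hm (hum.inter (hmpn.measurable hum)),
        Measure.map_apply hm hum, Measure.map_apply hm (hmpn.measurable hum), Set.preimage_inter]
      refine (Indep_iff _ _ _).mp (indep_noiseSigma hZ_meas hZ_indep hn) _ _ ?_ ?_
      · have : Measurable[noiseSigma Z I] fun ω (i : I) => Z i ω :=
          @measurable_pi_iff _ _ _ (noiseSigma Z I) _ _ |>.mpr fun i => measurable_noiseSigma i.2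
        exact this hS
      · have : Measurable[noiseSigma Z {k | k - n ∈ I}] fun ω (i : I) => Z (i + n) ω :=
          @measurable_pi_iff _ _ _ (noiseSigma Z {k | k - n ∈ I}) _ _ |>.mpr fun i =>
            measurable_noiseSigma (by simp)
        have h2 := this hS
        refine (congrArg (MeasurableSet[noiseSigma Z {k | k - n ∈ I}]) ?_).mp h2
        ext ω
        simp only [Set.mem_preimage, u, mem_cylinder, pathShift_iterate]
        rfl
    have hmix' : ν.real (u ∩ pathShift^[n] ⁻¹' u) = ν.real u ^ 2 := by
      rw [Measure.real, hmix, ENNReal.toReal_mul, sq, Measure.real]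
    have h1 : |ν.real s - ν.real u| ≤ ε :=
      (abs_measureReal_sub_le_measureReal_symmDiff hs.nullMeasurableSet
        hum.nullMeasurableSet).trans hsu'
    have h2 : ν.real (symmDiff s (pathShift^[n] ⁻¹' u)) ≤ ε := by
      have : symmDiff s (pathShift^[n] ⁻¹' u) = pathShift^[n] ⁻¹' (symmDiff s u) := by
        rw [Set.preimage_symmDiff, hinv' n]
      rw [this, Measure.real, hmpn.measure_preimage (hs.symmDiff hum).nullMeasurableSet]
      exact hsu'
    have h3 : |ν.real s - ν.real (u ∩ pathShift^[n] ⁻¹' u)| ≤ 2 * ε := by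
      refine (abs_measureReal_sub_le_measureReal_symmDiff hs.nullMeasurableSet
        (hum.inter (hmpn.measurable hum)).nullMeasurableSet).trans ?_
      calc _ ≤ ν.real (symmDiff s u ∪ symmDiff s (pathShift^[n] ⁻¹' u)) := by
            refine measureReal_mono ?_
            intro v
            simp only [Set.mem_symmDiff, Set.mem_inter_iff, Set.mem_union]
            tauto
        _ ≤ _ := (measureReal_union_le _ _).trans (by linarith)
    have h4 : |ν.real u ^ 2 - ν.real s ^ 2| ≤ 2 * ε := by
      have hu1 : ν.real u ≤ 1 := measureReal_le_one
      have hs1 : ν.real s ≤ 1 := measureReal_le_one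
      have hu0 : 0 ≤ ν.real u := measureReal_nonneg
      have hs0 : 0 ≤ ν.real s := measureReal_nonneg
      rw [sq_sub_sq, abs_mul, abs_sub_comm (ν.real u), abs_of_nonneg (add_nonneg hu0 hs0)]
      exact mul_le_mul (by linarith) h1 (abs_nonneg _) (by norm_num)
    rw [hmix'] at h3
    calc _ ≤ |ν.real s - ν.real u ^ 2| + |ν.real u ^ 2 - ν.real s ^ 2| := abs_sub_le _ _ _
      _ ≤ _ := by linarith
  have h0 : ν.real s - ν.real s ^ 2 = 0 := by
    by_contra hne
    have hpos := abs_pos.mpr hne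
    have := key (|ν.real s - ν.real s ^ 2| / 8) (by positivity)
    linarith
  have h01 : ν.real s = 0 ∨ ν.real s = 1 := by
    have : ν.real s * (1 - ν.real s) = 0 := by linear_combination h0
    rcases mul_eq_zero.mp this with h | h
    · exact Or.inl h
    · exact Or.inr (by linarith)
  rw [eventuallyConst_set']
  rcases h01 with h | h
  · left
    exact ae_eq_empty.mpr ((measureReal_eq_zero_iff).mp h)
  · right
    rw [ae_eq_univ, prob_compl_eq_zero_iff hs, ← ENNReal.ofReal_toReal (measure_ne_top ν s)]
    rw [Measure.real] at h
    rw [h, ENNReal.ofReal_one]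

/-- An equivariant measurable function of the i.i.d. noise is an ergodic process. -/
lemma isErgodicProcess_of_ae_eq {E : Type*} [MeasurableSpace E] (hZ_meas : ∀ t, Measurable (Z t))
    (hZ_indep : iIndepFun Z P) (hZ_ident : ∀ t, IdentDistrib (Z t) (Z 0) P P)
    {F : (ℤ → ℝ) → E} (hF : Measurable F) {V : ℤ → Ω → E}
    (hV : ∀ᵐ ω ∂P, ∀ t, V t ω = F fun s => Z (s + t) ω) : IsErgodicProcess P V := by
  have hm := measurable_path hZ_meas
  set Φ : (ℤ → ℝ) → ℤ → E := fun z t => F fun s => z (s + t) with hΦ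
  have hΦm : Measurable Φ := measurable_pi_iff.mpr fun t =>
    hF.comp (measurable_pi_iff.mpr fun s => measurable_pi_apply (s + t))
  have h1 : P.map (fun ω t => V t ω) = (P.map (fun ω t => Z t ω)).map Φ := by
    rw [Measure.map_map hΦm hm]
    refine Measure.map_congr ?_
    filter_upwards [hV] with ω hω
    exact funext hω
  unfold IsErgodicProcess
  rw [h1]
  refine MeasurePreserving.ergodic_of_ergodic_semiconj ⟨hΦm, rfl⟩
    (isErgodicProcess_of_iIndepFun hZ_meas hZ_indep hZ_ident) measurable_pathShift ?_
  intro z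
  ext t
  simp only [hΦ, pathShift]
  congr 1
  ext s
  congr 1
  ring

end Noise

/-! ### Measurability of the products with respect to windows of the noise -/

section ProductMeasurability

variable {Ω : Type*} {Z : ℤ → Ω → ℝ} {p q : ℕ} (α : Fin p → ℝ) (β : Fin q → ℝ) (γ : ℝ)

lemma measurable_agarchMatrix (i j : AGARCHIdx p q) :
    Measurable fun x => agarchMatrix α β γ x i j := by
  have h := measurable_asymSq γ
  rcases i with ⟨_ | k, hk⟩ | ⟨_ | k, hk⟩ <;> rcases j with j | j <;>
    simp only [agarchMatrix, Matrix.of_apply]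
  · split_ifs <;> fun_prop
  · fun_prop
  · fun_prop
  · fun_prop
  · split_ifs <;> fun_prop
  · fun_prop
  · fun_prop
  · fun_prop

lemma measurable_pathProd_of {m : MeasurableSpace Ω} (t : ℤ) (n : ℕ)
    (hZ : ∀ s, t - n ≤ s → s < t → Measurable[m] (Z s)) (i j : AGARCHIdx p q) :
    Measurable[m] fun ω => pathProd α β γ (fun s => Z s ω) t n i j := by
  induction n generalizing t i with
  | zero => exact measurable_const
  | succ n ih =>
    simp only [pathProd_succ, Matrix.mul_apply]
    refine Finset.measurable_sum _ fun l _ => Measurable.mul ?_ ?_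
    · exact (measurable_agarchMatrix α β γ i l).comp
        (hZ _ (by push_cast; omega) (by omega))
    · exact ih _ (fun s h1 h2 => hZ s (by push_cast; omega) (by omega)) l

lemma measurable_pathProd_noiseSigma (t : ℤ) (n : ℕ) (i j : AGARCHIdx p q) :
    Measurable[noiseSigma Z (Set.Ico (t - n) t)]
      fun ω => pathProd α β γ (fun s => Z s ω) t n i j :=
  measurable_pathProd_of (m := noiseSigma Z (Set.Ico (t - n) t)) α β γ t n
    (fun _ h1 h2 => measurable_noiseSigma ⟨h1, h2⟩) i j

lemma measurable_pathProd (t : ℤ) (n : ℕ) (i j : AGARCHIdx p q) :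
    Measurable fun z : ℤ → ℝ => pathProd α β γ z t n i j :=
  measurable_pathProd_of (Z := fun s (z : ℤ → ℝ) => z s) α β γ t n
    (fun s _ _ => measurable_pi_apply s) i j

lemma Measurable.opNorm_of_apply {m : MeasurableSpace Ω} {ι : Type*} [Fintype ι] [DecidableEq ι]
    {M : Ω → Matrix ι ι ℝ} (hM : ∀ i j, Measurable[m] fun ω => M ω i j) :
    Measurable[m] fun ω => opNorm (M ω) := by
  have hc : Continuous fun f : ι → ι → ℝ => opNorm (Matrix.of f) := by
    let L : (ι → ι → ℝ) →ₗ[ℝ] EuclideanSpace ℝ ι →L[ℝ] EuclideanSpace ℝ ι :=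
      { toFun := fun f => Matrix.toEuclideanCLM (𝕜 := ℝ) (Matrix.of f)
        map_add' := fun f g => map_add (Matrix.toEuclideanCLM (𝕜 := ℝ)) (Matrix.of f) (Matrix.of g)
        map_smul' := fun c f => map_smul (Matrix.toEuclideanCLM (𝕜 := ℝ)) c (Matrix.of f) }
    exact continuous_norm.comp L.continuous_of_finiteDimensional
  exact hc.measurable.comp (measurable_pi_iff.mpr fun i => measurable_pi_iff.mpr fun j => hM i j)

end ProductMeasurability

/-! ### Positive and negative parts of the logarithm -/

/-- The negative part of the logarithm of a nonnegative real number, with `log 0 = -∞`. -/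
def negLog (x : ℝ) : ℝ≥0∞ := if x = 0 then ⊤ else ENNReal.ofReal (-Real.log x)

@[simp] lemma negLog_zero : negLog 0 = ⊤ := if_pos rfl

lemma negLog_of_pos {x : ℝ} (hx : 0 < x) : negLog x = ENNReal.ofReal (-Real.log x) :=
  if_neg hx.ne'

lemma measurable_negLog : Measurable negLog :=
  Measurable.ite (measurableSet_singleton 0) measurable_const (by fun_prop)

/-- The hypothesis rewritten with positive and negative parts moved across, so that nothing is
subtracted in `ℝ≥0∞`. -/
lemma ofReal_add_ofReal_neg_le {x y z : ℝ} (h : x ≤ y + z) :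
    ENNReal.ofReal x + ENNReal.ofReal (-y) + ENNReal.ofReal (-z) ≤
      ENNReal.ofReal y + ENNReal.ofReal z + ENNReal.ofReal (-x) := by
  have e : ∀ a b c : ℝ, ENNReal.ofReal a + ENNReal.ofReal b + ENNReal.ofReal c =
      ENNReal.ofReal (max a 0 + max b 0 + max c 0) := fun a b c => by
    rw [ENNReal.ofReal_add (by positivity) (by positivity),
      ENNReal.ofReal_add (by positivity) (by positivity)]
    simp
  rw [e, e]
  refine ENNReal.ofReal_le_ofReal ?_
  have h1 : ∀ a : ℝ, max (-a) 0 = max a 0 - a := fun a => by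
    rcases le_total a 0 with ha | ha
    · rw [max_eq_left (by linarith), max_eq_right ha]; ring
    · rw [max_eq_right (by linarith), max_eq_left ha]; ring
  rw [h1, h1, h1]
  linarith

/-- Subadditivity of the logarithm in a form that remains valid for log 0 = -∞ and can be integrated
even if the negative parts have infinite mean. -/
lemma log_add_negLog_le {u v w : ℝ} (hu : 0 ≤ u) (hv : 0 ≤ v) (hw : 0 ≤ w) (h : u ≤ v * w) :
    ENNReal.ofReal (Real.log u) + negLog v + negLog w ≤
      ENNReal.ofReal (Real.log v) + ENNReal.ofReal (Real.log w) + negLog u := by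
  rcases hu.eq_or_lt with rfl | hu
  · simp
  have hvw : 0 < v * w := hu.trans_le h
  have hv' : 0 < v := hv.lt_of_ne fun h0 => by simp [← h0] at hvw
  have hw' : 0 < w := hw.lt_of_ne fun h0 => by simp [← h0] at hvw
  rw [negLog_of_pos hu, negLog_of_pos hv', negLog_of_pos hw']
  refine ofReal_add_ofReal_neg_le ?_
  rw [← Real.log_mul hv'.ne' hw'.ne']
  exact Real.log_le_log hu h

lemma toENNReal_logOpNorm {ι : Type*} [Fintype ι] [DecidableEq ι] (M : Matrix ι ι ℝ) :
    (logOpNorm M).toENNReal = ENNReal.ofReal (Real.log (opNorm M)) ∧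
      (-logOpNorm M).toENNReal = negLog (opNorm M) := by
  have h : logOpNorm M = ENNReal.log (ENNReal.ofReal (opNorm M)) := by
    rw [logOpNorm, opNorm, ofReal_norm]
  rw [h]
  rcases (opNorm_nonneg M).eq_or_lt with h0 | h0
  · simp [← h0]
  · rw [ENNReal.log_ofReal_of_pos h0, negLog_of_pos h0]
    exact ⟨rfl, rfl⟩

/-- Fekete's lemma for A - M with finite A and possibly infinite M. An infinite M persists for all
larger n and gives the limit -∞; otherwise A - M is a real subadditive sequence. The limit is
negative exactly when some term with n ≥ 1 is. -/
lemma fekete_sub {A M : ℕ → ℝ≥0∞} (hA : ∀ n, A n ≠ ⊤)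
    (hsub : ∀ m n, A (m + n) + M m + M n ≤ A m + A n + M (m + n)) :
    ∃ ρ : EReal, Tendsto (fun n : ℕ => ((1 / ((n : ℝ) + 1) : ℝ) : EReal) *
      ((A n : EReal) - (M n : EReal))) atTop (𝓝 ρ) ∧ (ρ < 0 ↔ ∃ n, n ≠ 0 ∧ A n < M n) := by
  have hpos : ∀ n : ℕ, (0 : ℝ) < 1 / ((n : ℝ) + 1) := fun n => by positivity
  by_cases htop : ∃ n, M n = ⊤
  · obtain ⟨n₀, hn₀⟩ := htop
    have hM : ∀ n, n₀ ≤ n → M n = ⊤ := by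
      intro n hn
      have h1 := hsub n₀ (n - n₀)
      rw [Nat.add_sub_cancel' hn, hn₀] at h1
      by_contra hne
      have : A n₀ + A (n - n₀) + M n ≠ ⊤ := by simp [hA, hne]
      exact this (top_le_iff.mp (by simpa using h1))
    refine ⟨⊥, ?_, ?_⟩
    · refine Tendsto.congr' ?_ tendsto_const_nhds
      filter_upwards [eventually_ge_atTop n₀] with n hn
      rw [hM n hn, EReal.coe_ennreal_top, EReal.sub_top, EReal.coe_mul_bot_of_pos (hpos n)]
    -- `n₀` itself may be 0, which is not admitted as a witness.
    · refine ⟨fun _ => ⟨n₀ + 1, by omega, ?_⟩, fun _ => EReal.bot_lt_zero⟩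
      rw [hM (n₀ + 1) (by omega)]
      exact (hA _).lt_top
  · push Not at htop
    set u : ℕ → ℝ := fun n => (A n).toReal - (M n).toReal with hu
    have hu_neg : ∀ n, u n < 0 ↔ A n < M n := fun n => by
      rw [hu, sub_neg, ENNReal.toReal_lt_toReal (hA n) (htop n)]
    have hsubu : Subadditive u := by
      intro m n
      have h1 := ENNReal.toReal_mono (by simp [hA, htop]) (hsub m n)
      rw [ENNReal.toReal_add (by simp [hA, htop]) (htop n),
        ENNReal.toReal_add (hA _) (htop m), ENNReal.toReal_add (by simp [hA]) (htop _),
        ENNReal.toReal_add (hA m) (hA n)] at h1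
      simp only [hu]
      linarith
    -- Passes from the normalization 1/(n+1) to Fekete's 1/n. The correction at n = 0 is needed
    -- because u 0 / 0 is 0 by convention.
    have hcoe : ∀ n : ℕ, ((1 / ((n : ℝ) + 1) : ℝ) : EReal) * ((A n : EReal) - (M n : EReal)) =
        (((n : ℝ) / (n + 1) * (u n / n) + (if n = 0 then u 0 else 0) : ℝ) : EReal) := by
      intro n
      have e : ∀ a : ℝ≥0∞, a ≠ ⊤ → (a : EReal) = (a.toReal : EReal) := fun a ha =>
        (EReal.coe_toReal (by simpa using ha) (by simp)).symm.trans (by simp)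
      rw [e _ (hA n), e _ (htop n), ← EReal.coe_sub, ← EReal.coe_mul]
      congr 1
      rcases eq_or_ne n 0 with rfl | hn
      · simp [hu]
      · have : (n : ℝ) ≠ 0 := Nat.cast_ne_zero.mpr hn
        simp only [hu, hn, if_false]
        field_simp
        ring
    simp only [hcoe]
    have hfrac : Tendsto (fun n : ℕ => (n : ℝ) / (n + 1)) atTop (𝓝 1) :=
      tendsto_natCast_div_add_atTop 1
    have hzero : Tendsto (fun n : ℕ => if n = 0 then u 0 else 0) atTop (𝓝 0) := by
      refine Tendsto.congr' ?_ tendsto_const_nhds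
      filter_upwards [eventually_ne_atTop 0] with n hn
      rw [if_neg hn]
    by_cases hbdd : BddBelow (Set.range fun n => u n / n)
    · have hlim := hsubu.tendsto_lim hbdd
      refine ⟨(hsubu.lim : EReal), ?_, ?_⟩
      · refine (continuous_coe_real_ereal.tendsto _).comp ?_
        simpa using (hfrac.mul hlim).add hzero
      · rw [EReal.coe_neg']
        constructor
        · intro h
          obtain ⟨n, hn, hn0⟩ := ((hlim.eventually_lt_const h).and
            (eventually_ne_atTop 0)).exists
          refine ⟨n, hn0, (hu_neg n).mp ?_⟩
          by_contra hge
          exact absurd hn (not_lt.mpr (div_nonneg (not_lt.mp hge) (Nat.cast_nonneg n)))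
        · rintro ⟨n, hn0, hn⟩
          exact (hsubu.lim_le_div hbdd hn0).trans_lt
            (div_neg_of_neg_of_pos ((hu_neg n).mpr hn) (by positivity))
    · have hdiv : ∀ L : ℝ, ∃ n : ℕ, n ≠ 0 ∧ u n / n < L := by
        intro L
        by_contra hcon
        push Not at hcon
        refine hbdd ⟨min L 0, ?_⟩
        rintro _ ⟨n, rfl⟩
        rcases eq_or_ne n 0 with rfl | hn
        · simp
        · exact (min_le_left _ _).trans (hcon n hn)
      have hlim : Tendsto (fun n : ℕ => u n / n) atTop atBot := by
        refine tendsto_atBot.mpr fun L => ?_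
        obtain ⟨n, hn, hL⟩ := hdiv L
        exact (hsubu.eventually_div_lt_of_div_lt hn hL).mono fun _ h => h.le
      refine ⟨⊥, ?_, ?_⟩
      · rw [EReal.tendsto_coe_nhds_bot_iff]
        exact (hfrac.pos_mul_atBot one_pos hlim).atBot_add hzero
      · refine ⟨fun _ => ?_, fun _ => EReal.bot_lt_zero⟩
        obtain ⟨n, hn, hL⟩ := hdiv 0
        refine ⟨n, hn, (hu_neg n).mp ?_⟩
        by_contra hge
        exact absurd hL (not_lt.mpr (div_nonneg (not_lt.mp hge) (Nat.cast_nonneg n)))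

/-! ### Negative mean logarithm, fractional moments, summability -/

section Moments

variable {Ω : Type*} [MeasurableSpace Ω] {P : Measure Ω}

lemma integral_neg_iff_lintegral_lt {U : Ω → ℝ} (hU : Integrable U P) :
    ∫ ω, U ω ∂P < 0 ↔ ∫⁻ ω, ENNReal.ofReal (U ω) ∂P < ∫⁻ ω, ENNReal.ofReal (-U ω) ∂P := by
  have h1 := hU.lintegral_lt_top.ne
  have h2 : ∫⁻ ω, ENNReal.ofReal (-U ω) ∂P ≠ ⊤ := hU.neg.lintegral_lt_top.ne
  rw [integral_eq_lintegral_pos_part_sub_lintegral_neg_part hU, sub_neg,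
    ENNReal.toReal_lt_toReal h1 h2]

/-- Only the dominating exponent has to be integrable; log w may be -∞ or have infinite negative
part. -/
lemma lintegral_log_lt_of_le_exp {w U : Ω → ℝ} (hw0 : ∀ ω, 0 ≤ w ω)
    (hU : Integrable U P) (hwU : ∀ᵐ ω ∂P, w ω ≤ Real.exp (U ω)) (hneg : ∫ ω, U ω ∂P < 0) :
    ∫⁻ ω, ENNReal.ofReal (Real.log (w ω)) ∂P < ∫⁻ ω, negLog (w ω) ∂P := by
  have h1 := (integral_neg_iff_lintegral_lt hU).mp hneg
  refine (lintegral_mono_ae ?_).trans_lt (h1.trans_le (lintegral_mono_ae ?_))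
  · filter_upwards [hwU] with ω hω
    rcases (hw0 ω).eq_or_lt with h | h
    · simp [← h]
    · exact ENNReal.ofReal_le_ofReal ((Real.log_le_iff_le_exp h).mpr hω)
  · filter_upwards [hwU] with ω hω
    rcases (hw0 ω).eq_or_lt with h | h
    · simp [← h]
    · rw [negLog_of_pos h]
      exact ENNReal.ofReal_le_ofReal (neg_le_neg ((Real.log_le_iff_le_exp h).mpr hω))

lemma tendsto_rpow_sub_one_div {x : ℝ} (hx : 0 < x) :
    Tendsto (fun n : ℕ => (x ^ (1 / ((n : ℝ) + 1)) - 1) / (1 / ((n : ℝ) + 1))) atTop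
      (𝓝 (Real.log x)) := by
  have h1 := (Real.hasStrictDerivAt_const_rpow hx 0).hasDerivAt.tendsto_slope
  rw [Real.rpow_zero, one_mul] at h1
  have h2 : Tendsto (fun n : ℕ => 1 / ((n : ℝ) + 1)) atTop (𝓝[≠] 0) :=
    tendsto_nhdsWithin_iff.mpr ⟨tendsto_one_div_add_atTop_nhds_zero_nat,
      Eventually.of_forall fun n => by
        have : (0 : ℝ) < 1 / ((n : ℝ) + 1) := by positivity
        exact this.ne'⟩
  refine (h1.comp h2).congr fun n => ?_
  simp only [Function.comp, slope_def_field, sub_zero, Real.rpow_zero]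

/-- If `E log w < 0`, then some fractional moment of `w` is smaller than one. -/
lemma exists_lintegral_rpow_lt_one [IsProbabilityMeasure P] {w : Ω → ℝ} (hwm : Measurable w)
    (hw0 : ∀ ω, 0 ≤ w ω) (hw : ∫⁻ ω, ENNReal.ofReal (w ω) ∂P ≠ ⊤)
    (hlog : ∫⁻ ω, ENNReal.ofReal (Real.log (w ω)) ∂P < ∫⁻ ω, negLog (w ω) ∂P) :
    ∃ s : ℝ, 0 < s ∧ s ≤ 1 ∧ ∫⁻ ω, ENNReal.ofReal (w ω ^ s) ∂P < 1 := by
  set s : ℕ → ℝ := fun n => 1 / ((n : ℝ) + 1) with hs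
  have hs0 : ∀ n, 0 < s n := fun n => by simp only [hs]; positivity
  have hs1 : ∀ n, s n ≤ 1 := fun n => by
    simp only [hs]
    rw [div_le_one (by positivity)]
    linarith [Nat.cast_nonneg (α := ℝ) n]
  set f : ℕ → Ω → ℝ := fun n ω => (w ω ^ s n - 1) / s n with hf
  have hfm : ∀ n, Measurable (f n) := fun n => by simp only [hf]; fun_prop
  -- Bernoulli's inequality for exponents in (0, 1]: (w^s - 1)/s ≤ w - 1. This dominates the
  -- positive parts.
  have hfle : ∀ n ω, f n ω ≤ w ω := by
    intro n ω
    have h1 := rpow_one_add_le_one_add_mul_self (s := w ω - 1) (by linarith [hw0 ω])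
      (hs0 n).le (hs1 n)
    rw [add_sub_cancel] at h1
    simp only [hf]
    rw [div_le_iff₀ (hs0 n)]
    nlinarith [hs0 n]
  have hlim_pos : Tendsto (fun n => ∫⁻ ω, ENNReal.ofReal (f n ω) ∂P) atTop
      (𝓝 (∫⁻ ω, ENNReal.ofReal (Real.log (w ω)) ∂P)) := by
    refine tendsto_lintegral_of_dominated_convergence (fun ω => ENNReal.ofReal (w ω))
      (fun n => (hfm n).ennreal_ofReal)
      (fun n => Eventually.of_forall fun ω => ENNReal.ofReal_le_ofReal (hfle n ω)) hw
      (Eventually.of_forall fun ω => ?_)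
    rcases (hw0 ω).eq_or_lt with h | h
    · have : ∀ n, ENNReal.ofReal (f n ω) = 0 := fun n => by
        rw [ENNReal.ofReal_eq_zero]
        exact (hfle n ω).trans h.ge
      simp [this, ← h]
    · exact (ENNReal.continuous_ofReal.tendsto _).comp (tendsto_rpow_sub_one_div h)
  -- The limit of the negative parts may have infinite mean, so only Fatou's lemma is used; a lower
  -- bound is all that is required. Where w = 0 the negative part is n + 1, which tends to ∞ as it
  -- should.
  have hlim_neg : ∫⁻ ω, negLog (w ω) ∂P ≤
      liminf (fun n => ∫⁻ ω, ENNReal.ofReal (-f n ω) ∂P) atTop := by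
    refine le_trans (le_of_eq (lintegral_congr fun ω => ?_))
      (lintegral_liminf_le fun n => (hfm n).neg.ennreal_ofReal)
    refine (Tendsto.liminf_eq ?_).symm
    rcases (hw0 ω).eq_or_lt with h | h
    · rw [← h, negLog_zero]
      have : ∀ n, -f n ω = (n : ℝ) + 1 := fun n => by
        simp only [hf, ← h, Real.zero_rpow (hs0 n).ne']
        simp [hs]
      simp only [this]
      refine ENNReal.tendsto_ofReal_atTop.comp ?_
      exact tendsto_atTop_add_const_right _ _ tendsto_natCast_atTop_atTop
    · rw [negLog_of_pos h]
      exact (ENNReal.continuous_ofReal.tendsto _).comp (tendsto_rpow_sub_one_div h).neg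
  obtain ⟨c, hc1, hc2⟩ := exists_between (hlog.trans_le hlim_neg)
  obtain ⟨n, hn1, hn2⟩ := ((hlim_pos.eventually_lt_const hc1).and
    (eventually_lt_of_lt_liminf hc2)).exists
  refine ⟨s n, hs0 n, hs1 n, ?_⟩
  have hw_int : Integrable w P :=
    ⟨hwm.aestronglyMeasurable, by
      rw [hasFiniteIntegral_iff_ofReal (Eventually.of_forall hw0)]
      exact hw.lt_top⟩
  have hws : Integrable (fun ω => w ω ^ s n) P := by
    refine Integrable.mono' (hw_int.add (integrable_const 1))
      (by have := hwm.pow_const (s n); exact this.aestronglyMeasurable)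
      (Eventually.of_forall fun ω => ?_)
    rw [Real.norm_of_nonneg (Real.rpow_nonneg (hw0 ω) _)]
    have h1 := hfle n ω
    simp only [hf] at h1
    rw [div_le_iff₀ (hs0 n)] at h1
    simp only [Pi.add_apply]
    nlinarith [hw0 ω, hs1 n]
  have hf_int : Integrable (f n) P := (hws.sub (integrable_const 1)).div_const _
  have hlt : ∫ ω, f n ω ∂P < 0 := (integral_neg_iff_lintegral_lt hf_int).mpr (hn1.trans hn2)
  have hlt' : ∫ ω, w ω ^ s n ∂P < 1 := by
    simp only [hf] at hlt
    rw [integral_div, integral_sub hws (integrable_const 1)] at hlt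
    have := (div_neg_iff.mp hlt).resolve_left fun h => absurd h.2 (not_lt.mpr (hs0 n).le)
    simpa using this.1
  rw [← ofReal_integral_eq_lintegral_ofReal hws
    (Eventually.of_forall fun ω => Real.rpow_nonneg (hw0 ω) _)]
  rwa [ENNReal.ofReal_lt_one]

/-- The partial sums S_n satisfy S_n ≤ ∑_{i<m} b_i + b_m S_n, and b_m < 1 bounds them. -/
lemma summable_of_submultiplicative {b : ℕ → ℝ≥0∞} (hfin : ∀ n, b n ≠ ⊤) {m : ℕ}
    (hm : b m < 1) (hsub : ∀ k, b (m + k) ≤ b m * b k) : ∑' n, b n ≠ ⊤ := by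
  have hsum : Summable fun n => (b n).toReal := by
    set κ := (b m).toReal with hκ
    have hκ0 : 0 ≤ κ := ENNReal.toReal_nonneg
    have hκ1 : κ < 1 := by
      rw [hκ, ← ENNReal.toReal_one]
      exact (ENNReal.toReal_lt_toReal (hfin m) ENNReal.one_ne_top).mpr hm
    refine summable_of_sum_range_le (c := (∑ i ∈ Finset.range m, (b i).toReal) / (1 - κ))
      (fun _ => ENNReal.toReal_nonneg) fun n => ?_
    rw [le_div_iff₀ (by linarith)]
    have h1 : ∑ i ∈ Finset.range n, (b i).toReal ≤
        ∑ i ∈ Finset.range (m + n), (b i).toReal :=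
      Finset.sum_le_sum_of_subset_of_nonneg (Finset.range_mono (by omega))
        fun _ _ _ => ENNReal.toReal_nonneg
    rw [Finset.sum_range_add] at h1
    have h2 : ∑ i ∈ Finset.range n, (b (m + i)).toReal ≤
        κ * ∑ i ∈ Finset.range n, (b i).toReal := by
      rw [Finset.mul_sum]
      refine Finset.sum_le_sum fun i _ => ?_
      rw [hκ, ← ENNReal.toReal_mul]
      exact ENNReal.toReal_mono (ENNReal.mul_ne_top (hfin _) (hfin _)) (hsub i)
    linarith
  have h := hsum.tsum_ofReal_ne_top
  simpa [ENNReal.ofReal_toReal (hfin _)] using h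

end Moments

/-! ### The top Lyapunov exponent and summability of the matrix products -/

section Lyapunov

variable {Ω : Type*} {Z : ℤ → Ω → ℝ} {p q : ℕ} (α : Fin p → ℝ) (β : Fin q → ℝ) (γ : ℝ)

lemma measurable_opNorm_pathProd_noiseSigma (t : ℤ) (k : ℕ) :
    Measurable[noiseSigma Z (Set.Ico (t - k) t)]
      fun ω => opNorm (pathProd α β γ (fun u => Z u ω) t k) :=
  Measurable.opNorm_of_apply fun i j => measurable_pathProd_noiseSigma α β γ t k i j

variable [mΩ : MeasurableSpace Ω] {P : Measure Ω}

lemma integrable_sq_of_integral_eq_one (hZ_var : ∫ ω, Z 0 ω ^ 2 ∂P = 1) :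
    Integrable (fun ω => Z 0 ω ^ 2) P := by
  by_contra h
  rw [integral_undef h] at hZ_var
  exact zero_ne_one hZ_var

lemma integrable_asymSq (hZ_meas : ∀ t, Measurable (Z t)) {γ : ℝ} (hγ : |γ| ≤ 1)
    (hZ_var : ∫ ω, Z 0 ω ^ 2 ∂P = 1) : Integrable (fun ω => asymSq γ (Z 0 ω)) P := by
  refine Integrable.mono' ((integrable_sq_of_integral_eq_one hZ_var).const_mul 4)
    ((measurable_asymSq γ).comp (hZ_meas 0)).aestronglyMeasurable
    (Eventually.of_forall fun ω => ?_)
  rw [Real.norm_of_nonneg (asymSq_nonneg _ _)]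
  exact asymSq_le hγ _

lemma measurable_opNorm_pathProd (hZ_meas : ∀ t, Measurable (Z t)) (t : ℤ) (k : ℕ) :
    Measurable fun ω => opNorm (pathProd α β γ (fun u => Z u ω) t k) :=
  Measurable.opNorm_of_apply fun i j =>
    measurable_pathProd_of α β γ t k (fun s _ _ => hZ_meas s) i j

lemma lintegral_path_shift (hZ_meas : ∀ t, Measurable (Z t)) (hZ_indep : iIndepFun Z P)
    (hZ_ident : ∀ t, IdentDistrib (Z t) (Z 0) P P) {G : (ℤ → ℝ) → ℝ≥0∞} (hG : Measurable G)
    (h : ℤ) : ∫⁻ ω, G (fun s => Z (s + h) ω) ∂P = ∫⁻ ω, G (fun s => Z s ω) ∂P :=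
  ((identDistrib_path_shift hZ_meas hZ_indep hZ_ident h).comp hG).lintegral_eq

lemma lintegral_pathProd_shift (hZ_meas : ∀ t, Measurable (Z t)) (hZ_indep : iIndepFun Z P)
    (hZ_ident : ∀ t, IdentDistrib (Z t) (Z 0) P P) {g : ℝ → ℝ≥0∞} (hg : Measurable g)
    (t t' : ℤ) (k : ℕ) :
    ∫⁻ ω, g (opNorm (pathProd α β γ (fun u => Z u ω) t k)) ∂P =
      ∫⁻ ω, g (opNorm (pathProd α β γ (fun u => Z u ω) t' k)) ∂P := by
  have hG : Measurable fun z : ℤ → ℝ => g (opNorm (pathProd α β γ z t' k)) :=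
    hg.comp (Measurable.opNorm_of_apply fun i j => measurable_pathProd α β γ t' k i j)
  rw [← lintegral_path_shift hZ_meas hZ_indep hZ_ident hG (t - t')]
  refine lintegral_congr fun ω => ?_
  rw [pathProd_shift α β γ (fun s => Z s ω)]
  congr 4
  ring

/-- The moment of order `s` of the norm of the matrix products. -/
def normMoment (P : Measure Ω) (Z : ℤ → Ω → ℝ) (s : ℝ) (t : ℤ) (k : ℕ) : ℝ≥0∞ :=
  ∫⁻ ω, ENNReal.ofReal (opNorm (pathProd α β γ (fun u => Z u ω) t k) ^ s) ∂P

lemma normMoment_shift (hZ_meas : ∀ t, Measurable (Z t)) (hZ_indep : iIndepFun Z P)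
    (hZ_ident : ∀ t, IdentDistrib (Z t) (Z 0) P P) (s : ℝ) (t t' : ℤ) (k : ℕ) :
    normMoment α β γ P Z s t k = normMoment α β γ P Z s t' k :=
  lintegral_pathProd_shift α β γ hZ_meas hZ_indep hZ_ident
    (g := fun x => ENNReal.ofReal (x ^ s)) (by fun_prop) t t' k

/-- The two blocks of factors use disjoint windows of the noise and are independent; stationarity
then moves the older block back to time t. -/
lemma normMoment_add_le (hZ_meas : ∀ t, Measurable (Z t)) (hZ_indep : iIndepFun Z P)
    (hZ_ident : ∀ t, IdentDistrib (Z t) (Z 0) P P) {s : ℝ} (hs : 0 ≤ s) (t : ℤ) (m k : ℕ) :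
    normMoment α β γ P Z s t (m + k) ≤
      normMoment α β γ P Z s t m * normMoment α β γ P Z s t k := by
  rw [normMoment_shift α β γ hZ_meas hZ_indep hZ_ident s t (t - m) k]
  unfold normMoment
  have hST : Disjoint (Set.Ico (t - m) t) (Set.Ico (t - m - k) (t - m)) :=
    Set.disjoint_left.mpr fun x hx hx' => absurd hx.1 (not_le.mpr hx'.2)
  have hpow : Measurable fun x : ℝ => ENNReal.ofReal (x ^ s) := by fun_prop
  refine le_of_le_of_eq (lintegral_mono fun ω => ?_)
    (lintegral_mul_of_noiseSigma hZ_meas hZ_indep hST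
      (hpow.comp (measurable_opNorm_pathProd_noiseSigma α β γ t m))
      (hpow.comp (measurable_opNorm_pathProd_noiseSigma α β γ (t - m) k)))
  rw [← ENNReal.ofReal_mul (Real.rpow_nonneg (opNorm_nonneg _) _),
    ← Real.mul_rpow (opNorm_nonneg _) (opNorm_nonneg _), pathProd_add]
  exact ENNReal.ofReal_le_ofReal
    (Real.rpow_le_rpow (opNorm_nonneg _) (opNorm_mul_le _ _) hs)

variable [IsProbabilityMeasure P]

/-- By submultiplicativity a single factor suffices, and its entries are affine in the integrable
variable (|Z_0| - γ Z_0)². -/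
lemma normMoment_one_ne_top (hZ_meas : ∀ t, Measurable (Z t)) (hZ_indep : iIndepFun Z P)
    (hZ_ident : ∀ t, IdentDistrib (Z t) (Z 0) P P) (hZ_var : ∫ ω, Z 0 ω ^ 2 ∂P = 1)
    {γ : ℝ} (hγ : |γ| ≤ 1) (hα : ∀ i, 0 ≤ α i) (t : ℤ) (k : ℕ) :
    normMoment α β γ P Z 1 t k ≠ ⊤ := by
  induction k with
  | zero => simp [normMoment]
  | succ k ih =>
    refine ne_top_of_le_ne_top ?_
      (normMoment_add_le α β γ hZ_meas hZ_indep hZ_ident zero_le_one t k 1)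
    refine ENNReal.mul_ne_top ih ?_
    rw [normMoment_shift α β γ hZ_meas hZ_indep hZ_ident 1 t 1]
    obtain ⟨C, hC0, hC⟩ := exists_opNorm_le (AGARCHIdx p q)
    obtain ⟨b, hb0, hb⟩ := exists_agarchMatrix_eq_add_mul α β γ hα
    set K := ∑ i, ∑ j, (|agarchMatrix α β γ 0 i j| + b i j) with hK
    have hentry : ∀ i j, |agarchMatrix α β γ 0 i j| + b i j ≤ K := by
      intro i j
      have hnn : ∀ i j, 0 ≤ |agarchMatrix α β γ 0 i j| + b i j := fun i j => by
        have := hb0 i j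
        positivity
      refine (Finset.single_le_sum (f := fun j => |agarchMatrix α β γ 0 i j| + b i j)
        (fun j _ => hnn i j) (Finset.mem_univ j)).trans ?_
      exact Finset.single_le_sum (f := fun i => ∑ j, (|agarchMatrix α β γ 0 i j| + b i j))
        (fun i _ => Finset.sum_nonneg fun j _ => hnn i j) (Finset.mem_univ i)
    have hint : Integrable (fun ω => C * (K * (1 + asymSq γ (Z 0 ω)))) P :=
      (((integrable_const 1).add (integrable_asymSq hZ_meas hγ hZ_var)).const_mul K).const_mul C
    refine ne_top_of_le_ne_top hint.lintegral_lt_top.ne (lintegral_mono fun ω => ?_)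
    refine ENNReal.ofReal_le_ofReal ?_
    rw [Real.rpow_one]
    refine hC _ _ fun i j => ?_
    have h1 : pathProd α β γ (fun u => Z u ω) 1 1 = agarchMatrix α β γ (Z 0 ω) := by
      rw [pathProd_succ, pathProd_zero, mul_one]
      simp
    have h8 := asymSq_nonneg γ (Z 0 ω)
    rw [h1, hb]
    calc _ ≤ |agarchMatrix α β γ 0 i j| + |b i j * asymSq γ (Z 0 ω)| := abs_add_le _ _
      _ ≤ (|agarchMatrix α β γ 0 i j| + b i j) * (1 + asymSq γ (Z 0 ω)) := by
        rw [abs_of_nonneg (mul_nonneg (hb0 i j) h8)]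
        have := mul_nonneg (abs_nonneg (agarchMatrix α β γ 0 i j)) h8
        have := hb0 i j
        nlinarith
      _ ≤ _ := mul_le_mul_of_nonneg_right (hentry i j) (by linarith)

lemma normMoment_ne_top (hZ_meas : ∀ t, Measurable (Z t)) (hZ_indep : iIndepFun Z P)
    (hZ_ident : ∀ t, IdentDistrib (Z t) (Z 0) P P) (hZ_var : ∫ ω, Z 0 ω ^ 2 ∂P = 1)
    {γ : ℝ} (hγ : |γ| ≤ 1) (hα : ∀ i, 0 ≤ α i) {s : ℝ} (hs0 : 0 ≤ s) (hs1 : s ≤ 1) (t : ℤ)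
    (k : ℕ) : normMoment α β γ P Z s t k ≠ ⊤ := by
  have h1 := normMoment_one_ne_top α β hZ_meas hZ_indep hZ_ident hZ_var hγ hα t k
  have h2 : normMoment α β γ P Z s t k ≤ 1 + normMoment α β γ P Z 1 t k := by
    have : (1 : ℝ≥0∞) = ∫⁻ _, 1 ∂P := by simp
    rw [this, normMoment, normMoment, ← lintegral_add_left measurable_const]
    refine lintegral_mono fun ω => ?_
    rw [← ENNReal.ofReal_one, ← ENNReal.ofReal_add zero_le_one
      (Real.rpow_nonneg (opNorm_nonneg _) _)]
    refine ENNReal.ofReal_le_ofReal ?_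
    set x := opNorm (pathProd α β γ (fun u => Z u ω) t k) with hx
    have hx0 : 0 ≤ x := opNorm_nonneg _
    rw [Real.rpow_one]
    rcases le_total x 1 with h | h
    · have := Real.rpow_le_one hx0 h hs0
      linarith
    · have := Real.rpow_le_rpow_of_exponent_le h hs1
      rw [Real.rpow_one] at this
      linarith
  exact ne_top_of_le_ne_top (by simp [h1]) h2

/-- The negative-drift condition: `E log ‖A_{0} ⋯ A_{-n+1}‖ < 0` for some `n ≥ 1`. -/
def HasNegDrift (P : Measure Ω) (Z : ℤ → Ω → ℝ) : Prop :=
  ∃ n : ℕ, n ≠ 0 ∧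
    ∫⁻ ω, ENNReal.ofReal (Real.log (opNorm (pathProd α β γ (fun u => Z u ω) 1 n))) ∂P <
      ∫⁻ ω, negLog (opNorm (pathProd α β γ (fun u => Z u ω) 1 n)) ∂P

lemma exists_isTopLyapunovExponent (hZ_meas : ∀ t, Measurable (Z t)) (hZ_indep : iIndepFun Z P)
    (hZ_ident : ∀ t, IdentDistrib (Z t) (Z 0) P P) (hZ_var : ∫ ω, Z 0 ω ^ 2 ∂P = 1)
    {γ : ℝ} (hγ : |γ| ≤ 1) (hα : ∀ i, 0 ≤ α i) :
    ∃ ρ : EReal, IsTopLyapunovExponent P α β γ Z ρ ∧ (ρ < 0 ↔ HasNegDrift α β γ P Z) := by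
  have hm := measurable_opNorm_pathProd (Z := Z) α β γ hZ_meas
  have key := fekete_sub
    (A := fun n => ∫⁻ ω, ENNReal.ofReal
      (Real.log (opNorm (pathProd α β γ (fun u => Z u ω) 1 n))) ∂P)
    (M := fun n => ∫⁻ ω, negLog (opNorm (pathProd α β γ (fun u => Z u ω) 1 n)) ∂P) ?_ ?_
  · obtain ⟨ρ, h1, h2⟩ := key
    refine ⟨ρ, ?_, h2⟩
    unfold IsTopLyapunovExponent
    refine h1.congr fun n => ?_
    rw [expectEReal]
    simp only [agarchProd_eq_pathProd, (toENNReal_logOpNorm _).1, (toENNReal_logOpNorm _).2]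
  · intro n
    refine ne_top_of_le_ne_top
      (normMoment_one_ne_top α β hZ_meas hZ_indep hZ_ident hZ_var hγ hα 1 n)
      (lintegral_mono fun ω => ENNReal.ofReal_le_ofReal ?_)
    rw [Real.rpow_one]
    exact Real.log_le_self (opNorm_nonneg _)
  · intro m n
    have hlog : Measurable fun x : ℝ => ENNReal.ofReal (Real.log x) := by fun_prop
    have e1 := lintegral_pathProd_shift α β γ hZ_meas hZ_indep hZ_ident hlog 1 (1 - m) n
    have e2 := lintegral_pathProd_shift α β γ hZ_meas hZ_indep hZ_ident measurable_negLog
      1 (1 - m) n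
    have hl : ∀ t k, Measurable fun ω => ENNReal.ofReal
        (Real.log (opNorm (pathProd α β γ (fun u => Z u ω) t k))) := fun t k => hlog.comp (hm t k)
    have hn : ∀ t k, Measurable fun ω => negLog (opNorm (pathProd α β γ (fun u => Z u ω) t k)) :=
      fun t k => measurable_negLog.comp (hm t k)
    simp only [e1, e2]
    rw [← lintegral_add_left (hl 1 (m + n)), ← lintegral_add_right _ (hn (1 - m) n),
      ← lintegral_add_left (hl 1 m), ← lintegral_add_right _ (hn 1 (m + n))]
    refine lintegral_mono fun ω => ?_
    refine log_add_negLog_le (opNorm_nonneg _) (opNorm_nonneg _) (opNorm_nonneg _) ?_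
    rw [pathProd_add]
    exact opNorm_mul_le _ _

/-- The fractional moment below 1 makes the norms to the power s summable in mean, hence almost
surely. -/
lemma HasNegDrift.ae_summable (hZ_meas : ∀ t, Measurable (Z t)) (hZ_indep : iIndepFun Z P)
    (hZ_ident : ∀ t, IdentDistrib (Z t) (Z 0) P P) (hZ_var : ∫ ω, Z 0 ω ^ 2 ∂P = 1)
    {γ : ℝ} (hγ : |γ| ≤ 1) {α : Fin p → ℝ} {β : Fin q → ℝ} (hα : ∀ i, 0 ≤ α i)
    (h : HasNegDrift α β γ P Z) :
    ∀ᵐ ω ∂P, ∀ t, Summable fun k => opNorm (pathProd α β γ (fun u => Z u ω) t k) := by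
  obtain ⟨n, -, hlt⟩ := h
  have hm := measurable_opNorm_pathProd (Z := Z) α β γ hZ_meas
  obtain ⟨s, hs0, hs1, hs⟩ := exists_lintegral_rpow_lt_one (hm 1 n) (fun ω => opNorm_nonneg _)
    (by simpa [normMoment] using
      normMoment_one_ne_top α β hZ_meas hZ_indep hZ_ident hZ_var hγ hα 1 n) hlt
  rw [ae_all_iff]
  intro t
  have hsum : ∑' k, normMoment α β γ P Z s t k ≠ ⊤ := by
    refine summable_of_submultiplicative (m := n)
      (fun k => normMoment_ne_top α β hZ_meas hZ_indep hZ_ident hZ_var hγ hα hs0.le hs1 t k) ?_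
      (fun k => normMoment_add_le α β γ hZ_meas hZ_indep hZ_ident hs0.le t n k)
    rw [normMoment_shift α β γ hZ_meas hZ_indep hZ_ident s t 1]
    exact hs
  have hmeas : ∀ k, Measurable fun ω =>
      ENNReal.ofReal (opNorm (pathProd α β γ (fun u => Z u ω) t k) ^ s) :=
    fun k => ((hm t k).pow_const s).ennreal_ofReal
  unfold normMoment at hsum
  rw [← lintegral_tsum fun k => (hmeas k).aemeasurable] at hsum
  filter_upwards [ae_lt_top (Measurable.tsum hmeas) hsum] with ω hω
  have h1 : Summable fun k => opNorm (pathProd α β γ (fun u => Z u ω) t k) ^ s := by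
    have := ENNReal.summable_toReal hω.ne
    refine this.congr fun k => ?_
    rw [ENNReal.toReal_ofReal (Real.rpow_nonneg (opNorm_nonneg _) _)]
  -- Eventually the norms are at most 1, where x ≤ x^s because s ≤ 1.
  refine Summable.of_norm_bounded_eventually_nat h1 ?_
  filter_upwards [h1.tendsto_atTop_zero.eventually_lt_const one_pos] with k hk
  rw [Real.norm_of_nonneg (opNorm_nonneg _)]
  have h0 := opNorm_nonneg (pathProd α β γ (fun u => Z u ω) t k)
  have hle : opNorm (pathProd α β γ (fun u => Z u ω) t k) ≤ 1 := by
    by_contra hgt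
    push Not at hgt
    exact absurd hk (not_lt.mpr (Real.one_le_rpow hgt.le hs0.le))
  rcases h0.eq_or_lt with h0 | h0
  · rw [← h0]
    exact Real.rpow_nonneg le_rfl _
  · have := Real.rpow_le_rpow_of_exponent_ge h0 hle hs1
    rwa [Real.rpow_one] at this

end Lyapunov

/-! ### A stationary solution forces negative drift -/

section NegativeDrift

variable {Ω : Type*} [mΩ : MeasurableSpace Ω] {P : Measure Ω}
  {Z : ℤ → Ω → ℝ} {p q : ℕ} {α : Fin p → ℝ} {β : Fin q → ℝ} {γ α₀ : ℝ}
  {X σ : ℤ → Ω → ℝ}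

lemma IsAGARCHSolution.ae_recursion (hsol : IsAGARCHSolution P Z α₀ α β γ X σ) :
    ∀ᵐ ω ∂P, ∀ t, σ t ω ^ 2 =
      volRec α β γ (fun s => Z s ω) α₀ (fun s => σ s ω ^ 2) t := by
  filter_upwards [hsol.nonneg, hsol.eq_X, hsol.eq_σ] with ω h0 hX hσ t
  rw [hσ t, volRec]
  congr 2
  refine Finset.sum_congr rfl fun i _ => ?_
  rw [hX, asymSq_mul_of_nonneg _ (h0 _), mul_comm (σ _ _ ^ 2)]

lemma IsAGARCHSolution.ae_le_sq (hsol : IsAGARCHSolution P Z α₀ α β γ X σ)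
    (hα : ∀ i, 0 ≤ α i) (hβ : ∀ j, 0 ≤ β j) : ∀ᵐ ω ∂P, ∀ t, α₀ ≤ σ t ω ^ 2 := by
  filter_upwards [hsol.eq_σ] with ω hσ t
  rw [hσ t]
  have h1 : 0 ≤ ∑ i : Fin p, α i * asymSq γ (X (t - ((i : ℕ) + 1)) ω) :=
    Finset.sum_nonneg fun i _ => mul_nonneg (hα i) (asymSq_nonneg _ _)
  have h2 : 0 ≤ ∑ j : Fin q, β j * σ (t - ((j : ℕ) + 1)) ω ^ 2 :=
    Finset.sum_nonneg fun j _ => mul_nonneg (hβ j) (sq_nonneg _)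
  linarith

lemma IsAGARCHSolution.ae_state_eq (hsol : IsAGARCHSolution P Z α₀ α β γ X σ) :
    ∀ᵐ ω ∂P, ∀ t, agarchState p q γ X σ t ω =
      pathState p q γ (fun s => σ s ω ^ 2) (fun s => Z s ω) t := by
  filter_upwards [hsol.nonneg, hsol.eq_X] with ω h0 hX t
  ext i
  rcases i with i | i
  · rfl
  · simp only [agarchState, pathState]
    rw [hX, asymSq_mul_of_nonneg _ (h0 _), mul_comm]

lemma integral_freshRatio (hst : IsStationaryProcess P (fun t ω => (X t ω, σ t ω))) (t : ℤ) :
    ∫ ω, freshRatio p q α₀ (fun s => σ s ω ^ 2) t ∂P =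
      ∫ ω, freshRatio p q α₀ (fun s => σ s ω ^ 2) 0 ∂P := by
  have hG : Measurable fun v : ℤ → ℝ × ℝ =>
      freshRatio p q α₀ (fun s => (v s).2 ^ 2) 0 := by
    unfold freshRatio
    fun_prop
  have h := ((hst t).comp hG).integral_eq
  simp only [Function.comp_def] at h
  rw [← h]
  refine integral_congr_ae (Eventually.of_forall fun ω => ?_)
  simp only [freshRatio]
  congr 1
  refine Finset.sum_congr rfl fun k _ => ?_
  rw [show (0 : ℤ) - k + t = t - k by ring]

variable [IsProbabilityMeasure P]

lemma exists_measure_lt_of_measurable {V : Ω → ℝ} (hV : Measurable V) {ε : ℝ} (hε : 0 < ε) :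
    ∃ K : ℕ, P.real {ω | (K : ℝ) < V ω} < ε := by
  have h1 : Tendsto (fun K : ℕ => P {ω | (K : ℝ) < V ω}) atTop
      (𝓝 (P (⋂ K : ℕ, {ω | (K : ℝ) < V ω}))) := by
    refine tendsto_measure_iInter_atTop
      (fun K => (measurableSet_lt measurable_const hV).nullMeasurableSet) ?_
      ⟨0, measure_ne_top _ _⟩
    intro m n hmn ω hω
    simp only [Set.mem_ofPred_eq] at hω ⊢
    exact (Nat.cast_le.mpr hmn).trans_lt hω
  have h2 : (⋂ K : ℕ, {ω | (K : ℝ) < V ω}) = ∅ := by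
    ext ω
    simp only [Set.mem_iInter, Set.mem_ofPred_eq, Set.mem_empty_iff_false, iff_false, not_forall,
      not_lt]
    exact exists_nat_ge (V ω)
  rw [h2, measure_empty] at h1
  have h3 := (ENNReal.tendsto_toReal ENNReal.zero_ne_top).comp h1
  exact (h3.eventually_lt_const (by simpa using hε)).exists

/-- If a stationary solution exists, then the products of the matrices contract on average. -/
lemma IsStationaryAGARCH.hasNegDrift (hZ_meas : ∀ t, Measurable (Z t))
    (hZ_ident : ∀ t, IdentDistrib (Z t) (Z 0) P P) (hZ_var : ∫ ω, Z 0 ω ^ 2 ∂P = 1)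
    (hγ : |γ| ≤ 1) (hα₀ : 0 < α₀) (hα : ∀ i, 0 ≤ α i) (hβ : ∀ j, 0 ≤ β j)
    (h : IsStationaryAGARCH P Z α₀ α β γ X σ) : HasNegDrift α β γ P Z := by
  obtain ⟨hsol, hst⟩ := h
  obtain ⟨c, hc0, hc⟩ := exists_sum_agarchMatrix_le (β := β) hα hγ
  obtain ⟨C, hC0, hC⟩ := exists_opNorm_le (AGARCHIdx p q)
  set D := memLength p q with hD
  have hDpos : 0 < D := memLength_pos
  have hDpos' : (0 : ℝ) < D := Nat.cast_pos.mpr hDpos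
  set δ : ℤ → Ω → ℝ := fun t ω => freshRatio p q α₀ (fun s => σ s ω ^ 2) t with hδ
  have hσm := hsol.measurable_σ
  have hδm : ∀ t, Measurable (δ t) := fun t => by
    simp only [hδ, freshRatio]
    refine measurable_const.div (Finset.measurable_sum _ fun k _ => (hσm _).pow_const 2)
  have hlow := hsol.ae_le_sq hα hβ
  have hδ01 : ∀ᵐ ω ∂P, ∀ t, 0 < δ t ω ∧ δ t ω ≤ 1 := by
    filter_upwards [hlow] with ω hω t
    exact ⟨freshRatio_pos hα₀ hω t, freshRatio_le_one hα₀ hω t⟩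
  have hδint : ∀ t, Integrable (δ t) P := fun t => by
    refine Integrable.mono' (integrable_const 1) (hδm t).aestronglyMeasurable ?_
    filter_upwards [hδ01] with ω hω
    rw [Real.norm_of_nonneg (hω t).1.le]
    exact (hω t).2
  set d := ∫ ω, δ 0 ω ∂P with hd
  have hδd : ∀ t, ∫ ω, δ t ω ∂P = d := integral_freshRatio hst
  have hdpos : 0 < d := by
    rw [hd, integral_pos_iff_support_of_nonneg_ae
      (hδ01.mono fun ω hω => (hω 0).1.le) (hδint 0)]
    have : Function.support (δ 0) =ᵐ[P] Set.univ := by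
      filter_upwards [hδ01] with ω hω
      exact eq_true (hω 0).1.ne'
    rw [measure_congr this, measure_univ]
    exact one_pos
  have hsq : ∀ t, Integrable (fun ω => Z t ω ^ 2) P ∧ ∫ ω, Z t ω ^ 2 ∂P = 1 := fun t => by
    have hid := (hZ_ident t).comp (measurable_id.pow_const 2)
    exact ⟨(hid.integrable_iff).mpr (integrable_sq_of_integral_eq_one hZ_var),
      hid.integral_eq.trans hZ_var⟩
  -- Parameter of |x| ≤ θ x²/2 + 1/(2θ). With this value the quadratic terms over n + 1 blocks have
  -- mean (n + 1) d/4.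
  set θ := d / (2 * D) with hθ
  have hθpos : 0 < θ := by positivity
  set V : Ω → ℝ := fun ω =>
    ∑ i, pathState p q γ (fun s => σ s ω ^ 2) (fun s => Z s ω) 1 i with hV
  have hVm : Measurable V := by
    refine Finset.measurable_sum _ fun i _ => ?_
    rcases i with i | i
    · exact (hσm _).pow_const 2
    · exact ((measurable_asymSq γ).comp (hZ_meas _)).mul ((hσm _).pow_const 2)
  -- Price per block of the crude bound on the exceptional event: D c + D/(2θ) for the growth of the
  -- matrices, and 1 to make up for the subtracted ratios, each at most 1. The event gets
  -- probability below d/(4W), so it costs at most d/4 per block in the mean.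
  set W : ℝ := 1 + D * c + D / (2 * θ) with hW
  have hWpos : 0 < W := by positivity
  obtain ⟨K, hK⟩ := exists_measure_lt_of_measurable (P := P) hVm
    (show 0 < d / (4 * W) by positivity)
  -- log V need not be integrable, so the contraction estimate is used only off this event. The
  -- event depends on the noise, which is why the quadratic terms in `U` carry no indicator.
  set B : Set Ω := {ω | (K : ℝ) < V ω} with hB
  have hBm : MeasurableSet B := measurableSet_lt measurable_const hVm
  set η := P.real B with hη
  set C₀ : ℝ := |Real.log (C / α₀ * (K + 1))| + |Real.log C| with hC₀
  -- a random variable that dominates the logarithm of the norm of a long product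
  set U : ℕ → Ω → ℝ := fun n ω => C₀ +
    ∑ l ∈ Finset.range D, (c + (1 + Z (1 - (n * D : ℕ) - ((l : ℤ) + 1)) ω ^ 2)) -
    ∑ j ∈ Finset.range n, δ (1 - (j * D : ℕ)) ω +
    B.indicator (fun _ => (n + 1) * W) ω +
    ∑ l ∈ Finset.range (n * D + D), θ / 2 * Z (1 - ((l : ℤ) + 1)) ω ^ 2 with hU
  have hBint : ∀ r : ℝ, Integrable (B.indicator fun _ => r) P := fun r =>
    (integrable_const r).indicator hBm
  have i0 : ∀ t, Integrable (fun ω => 1 + Z t ω ^ 2) P := fun t =>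
    (integrable_const 1).add (hsq _).1
  have i0' : ∀ t, Integrable (fun ω => c + (1 + Z t ω ^ 2)) P := fun t =>
    (integrable_const c).add (i0 t)
  have i1 : ∀ n, Integrable (fun ω => ∑ l ∈ Finset.range D,
      (c + (1 + Z (1 - (n * D : ℕ) - ((l : ℤ) + 1)) ω ^ 2))) P := fun n =>
    integrable_finsetSum _ fun l _ => i0' _
  have i2 : ∀ n, Integrable (fun ω => ∑ j ∈ Finset.range n, δ (1 - (j * D : ℕ)) ω) P := fun n =>
    integrable_finsetSum _ fun j _ => hδint _
  have i3 : ∀ n, Integrable (fun ω => ∑ l ∈ Finset.range (n * D + D),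
      θ / 2 * Z (1 - ((l : ℤ) + 1)) ω ^ 2) P := fun n =>
    integrable_finsetSum _ fun l _ => (hsq _).1.const_mul _
  have j1 : ∀ n, Integrable (fun ω => C₀ + ∑ l ∈ Finset.range D,
      (c + (1 + Z (1 - (n * D : ℕ) - ((l : ℤ) + 1)) ω ^ 2))) P := fun n =>
    (integrable_const C₀).add (i1 n)
  have j2 : ∀ n, Integrable (fun ω => C₀ + ∑ l ∈ Finset.range D,
      (c + (1 + Z (1 - (n * D : ℕ) - ((l : ℤ) + 1)) ω ^ 2)) -
      ∑ j ∈ Finset.range n, δ (1 - (j * D : ℕ)) ω) P := fun n => (j1 n).sub (i2 n)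
  have j3 : ∀ n : ℕ, Integrable (fun ω => C₀ + ∑ l ∈ Finset.range D,
      (c + (1 + Z (1 - (n * D : ℕ) - ((l : ℤ) + 1)) ω ^ 2)) -
      ∑ j ∈ Finset.range n, δ (1 - (j * D : ℕ)) ω + B.indicator (fun _ => (n + 1) * W) ω) P :=
    fun n => (j2 n).add (hBint _)
  have hUint : ∀ n, Integrable (U n) P := fun n => (j3 n).add (i3 n)
  have hUval : ∀ n : ℕ, ∫ ω, U n ω ∂P =
      C₀ + D * (c + 2) - n * d + η * ((n + 1) * W) + (n * D + D) * (θ / 2) := by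
    intro n
    have e1 : ∫ ω, ∑ l ∈ Finset.range D,
        (c + (1 + Z (1 - (n * D : ℕ) - ((l : ℤ) + 1)) ω ^ 2)) ∂P = D * (c + 2) := by
      rw [integral_finsetSum _ fun l _ => i0' _]
      have : ∀ t, ∫ ω, (c + (1 + Z t ω ^ 2)) ∂P = c + 2 := fun t => by
        rw [integral_add (integrable_const c) (i0 t),
          integral_add (integrable_const 1) (hsq _).1, (hsq t).2]
        simp only [integral_const, probReal_univ, smul_eq_mul]
        ring
      simp only [this, Finset.sum_const, Finset.card_range, nsmul_eq_mul]
    have e2 : ∫ ω, ∑ j ∈ Finset.range n, δ (1 - (j * D : ℕ)) ω ∂P = n * d := by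
      rw [integral_finsetSum _ fun j _ => hδint _]
      simp only [hδd, Finset.sum_const, Finset.card_range, nsmul_eq_mul]
    have e3 : ∫ ω, ∑ l ∈ Finset.range (n * D + D), θ / 2 * Z (1 - ((l : ℤ) + 1)) ω ^ 2 ∂P =
        (n * D + D) * (θ / 2) := by
      rw [integral_finsetSum _ fun l _ => (hsq _).1.const_mul _]
      simp only [integral_const_mul, (hsq _).2, Finset.sum_const, Finset.card_range, nsmul_eq_mul]
      push_cast
      ring
    simp only [hU]
    rw [integral_add (j3 n) (i3 n), integral_add (j2 n) (hBint _), integral_sub (j1 n) (i2 n),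
      integral_add (integrable_const C₀) (i1 n), e1, e2, e3, integral_indicator_const _ hBm]
    simp only [integral_const, probReal_univ, smul_eq_mul, one_mul, ← hη]
  have hUdom : ∀ n : ℕ, ∀ᵐ ω ∂P,
      opNorm (pathProd α β γ (fun u => Z u ω) 1 (n * D + D)) ≤ Real.exp (U n ω) := by
    intro n
    filter_upwards [hlow, hδ01, hsol.ae_recursion] with ω hω1 hω2 hω3
    have habs : ∀ x : ℝ, |x| ≤ 1 + x ^ 2 := fun x => by
      nlinarith [sq_nonneg (|x| - 1), sq_abs x]
    have hsum1 : ∑ l ∈ Finset.range D, (c + |Z (1 - (n * D : ℕ) - ((l : ℤ) + 1)) ω|) ≤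
        ∑ l ∈ Finset.range D, (c + (1 + Z (1 - (n * D : ℕ) - ((l : ℤ) + 1)) ω ^ 2)) :=
      Finset.sum_le_sum fun l _ => by linarith [habs (Z (1 - (n * D : ℕ) - ((l : ℤ) + 1)) ω)]
    have hsum3 : 0 ≤ ∑ l ∈ Finset.range (n * D + D), θ / 2 * Z (1 - ((l : ℤ) + 1)) ω ^ 2 :=
      Finset.sum_nonneg fun l _ => by positivity
    by_cases hωB : ω ∈ B
    · refine (hC _ _ fun i j => abs_pathProd_le hc 1 (n * D + D) i j).trans ?_
      rw [← Real.exp_log hC0, ← Real.exp_add]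
      refine Real.exp_le_exp.mpr ?_
      have hlogC : Real.log C ≤ C₀ := (le_abs_self _).trans (by simp [hC₀])
      have hsum4 : ∑ j ∈ Finset.range n, δ (1 - (j * D : ℕ)) ω ≤ n := by
        refine (Finset.sum_le_sum fun j _ => (hω2 _).2).trans ?_
        simp
      have hsum5 : 0 ≤ ∑ l ∈ Finset.range D,
          (c + (1 + Z (1 - (n * D : ℕ) - ((l : ℤ) + 1)) ω ^ 2)) :=
        Finset.sum_nonneg fun l _ => by positivity
      have hsum6 : ∑ l ∈ Finset.range (n * D + D), (c + |Z (1 - ((l : ℤ) + 1)) ω|) ≤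
          (n * D + D) * (c + 1 / (2 * θ)) +
          ∑ l ∈ Finset.range (n * D + D), θ / 2 * Z (1 - ((l : ℤ) + 1)) ω ^ 2 := by
        have : ((n * D + D : ℕ) : ℝ) * (c + 1 / (2 * θ)) =
            ∑ l ∈ Finset.range (n * D + D), (c + 1 / (2 * θ)) := by
          rw [Finset.sum_const, Finset.card_range, nsmul_eq_mul]
        rw [Nat.cast_add, Nat.cast_mul] at this
        rw [this, ← Finset.sum_add_distrib]
        refine Finset.sum_le_sum fun l _ => ?_
        set x := Z (1 - ((l : ℤ) + 1)) ω
        have h2 : 0 ≤ (θ * |x| - 1) ^ 2 / (2 * θ) := by positivity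
        have h3 : (θ * |x| - 1) ^ 2 / (2 * θ) = θ / 2 * x ^ 2 - |x| + 1 / (2 * θ) := by
          rw [← sq_abs x]
          field_simp
          ring
        linarith
      simp only [hU, Set.indicator_of_mem hωB]
      have hWn : ((n : ℝ) + 1) * W = (n + 1) + (n * D + D) * (c + 1 / (2 * θ)) := by
        rw [hW]; ring
      rw [hWn]
      linarith
    -- K + 1 in place of K keeps the argument of the logarithm positive when K = 0.
    · have hVK : V ω ≤ K + 1 := by
        have : V ω ≤ K := not_lt.mp hωB
        linarith
      have hVpos : 0 ≤ V ω := Finset.sum_nonneg fun i _ =>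
        pathState_nonneg (fun t => sq_nonneg _) 1 i
      refine (hC _ _ fun i j =>
        pathProd_le_of_recursion hα₀ hα hβ hω1 hω3 hc0 hc 1 n i j).trans ?_
      have hpos : 0 < C / α₀ * (K + 1) := by positivity
      have hlogC : Real.log (C / α₀ * (K + 1)) ≤ C₀ := (le_abs_self _).trans (by simp [hC₀])
      calc _ ≤ C * (Real.exp (∑ l ∈ Finset.range D,
              (c + (1 + Z (1 - (n * D : ℕ) - ((l : ℤ) + 1)) ω ^ 2))) / α₀ *
            Real.exp (-∑ j ∈ Finset.range n, δ (1 - (j * D : ℕ)) ω) * (K + 1)) := by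
            gcongr
        _ = Real.exp (Real.log (C / α₀ * (K + 1)) + ∑ l ∈ Finset.range D,
              (c + (1 + Z (1 - (n * D : ℕ) - ((l : ℤ) + 1)) ω ^ 2)) +
              -∑ j ∈ Finset.range n, δ (1 - (j * D : ℕ)) ω) := by
            rw [Real.exp_add, Real.exp_add, Real.exp_log hpos]
            ring
        _ ≤ _ := by
            refine Real.exp_le_exp.mpr ?_
            simp only [hU, Set.indicator_of_notMem hωB]
            linarith
  -- The mean of `U n` is at most C₀ + D (c + 2) - n d + 2 (n + 1) d/4, which is negative for this
  -- n.
  obtain ⟨n, hn⟩ := exists_nat_gt ((C₀ + D * (c + 2) + d) / (d / 4))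
  rw [div_lt_iff₀ (by positivity)] at hn
  refine ⟨n * D + D, by omega, lintegral_log_lt_of_le_exp (fun ω => opNorm_nonneg _)
    (hUint n) (hUdom n) ?_⟩
  rw [hUval]
  have h1 : η * ((n + 1) * W) ≤ (n + 1) * (d / 4) := by
    have h2 : η * W ≤ d / 4 := by
      have := mul_le_mul_of_nonneg_right hK.le hWpos.le
      rwa [show d / (4 * W) * W = d / 4 by field_simp] at this
    nlinarith [Nat.cast_nonneg (α := ℝ) n]
  have h3 : ((n : ℝ) * D + D) * (θ / 2) = (n + 1) * (d / 4) := by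
    rw [hθ]
    field_simp
    ring
  rw [h3]
  nlinarith

end NegativeDrift

/-! ### The stationary solution as a function of the noise -/

section PathVolatility

variable {p q : ℕ} (α : Fin p → ℝ) (β : Fin q → ℝ) (γ α₀ : ℝ)

/-- The squared volatility at time `0`, as a function of the path of the noise. -/
def pathVol (z : ℤ → ℝ) : ℝ≥0∞ :=
  ∑' k : ℕ, ENNReal.ofReal ((pathProd α β γ z 0 k *ᵥ agarchVec p q α₀) (idxZero p q))

/-- The volatility at time `0`, as a function of the path of the noise. -/
def pathSigma (z : ℤ → ℝ) : ℝ := √(pathVol α β γ α₀ z).toReal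

lemma pathSigma_nonneg (z : ℤ → ℝ) : 0 ≤ pathSigma α β γ α₀ z := Real.sqrt_nonneg _

lemma pathSigma_sq (z : ℤ → ℝ) : pathSigma α β γ α₀ z ^ 2 = (pathVol α β γ α₀ z).toReal :=
  Real.sq_sqrt ENNReal.toReal_nonneg

lemma pathVol_shift (z : ℤ → ℝ) (t : ℤ) : pathVol α β γ α₀ (fun s => z (s + t)) =
    ∑' k : ℕ, ENNReal.ofReal ((pathProd α β γ z t k *ᵥ agarchVec p q α₀) (idxZero p q)) := by
  simp only [pathVol, pathProd_shift, zero_add]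

lemma measurable_mulVec_agarchVec_of {Ω : Type*} {m : MeasurableSpace Ω}
    {M : Ω → Matrix (AGARCHIdx p q) (AGARCHIdx p q) ℝ}
    (hM : ∀ i j, Measurable[m] fun ω => M ω i j) (i : AGARCHIdx p q) :
    Measurable[m] fun ω => (M ω *ᵥ agarchVec p q α₀) i := by
  simp only [Matrix.mulVec, dotProduct]
  exact Finset.measurable_sum _ fun j _ => (hM i j).mul_const _

lemma measurable_pathSigma_shift_of {Ω : Type*} {m : MeasurableSpace Ω} {Z : ℤ → Ω → ℝ} {t : ℤ}
    (hZ : ∀ s < t, Measurable[m] (Z s)) :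
    Measurable[m] fun ω => pathSigma α β γ α₀ fun s => Z (s + t) ω := by
  unfold pathSigma
  simp only [fun ω => pathVol_shift α β γ α₀ (fun s => Z s ω) t]
  refine (Measurable.ennreal_toReal (Measurable.tsum fun k => Measurable.ennreal_ofReal ?_)).sqrt
  exact measurable_mulVec_agarchVec_of α₀
    (fun i j => measurable_pathProd_of α β γ t k (fun s _ hs => hZ s hs) i j) _

lemma measurable_pathSigma : Measurable (pathSigma α β γ α₀) := by
  have := measurable_pathSigma_shift_of α β γ α₀ (Z := fun s (z : ℤ → ℝ) => z s) (t := 0)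
    fun s _ => measurable_pi_apply s
  simpa using this

variable {α β γ α₀}

lemma measurable_pathSigma_noiseSigma {Ω : Type*} {Z : ℤ → Ω → ℝ} (t : ℤ) :
    Measurable[noiseSigma Z (Set.Iic (t - 1))]
      fun ω => pathSigma α β γ α₀ fun s => Z (s + t) ω :=
  measurable_pathSigma_shift_of (m := noiseSigma Z (Set.Iic (t - 1))) α β γ α₀
    fun _ hs => measurable_noiseSigma (Set.mem_Iic.mpr (by omega))

variable {z : ℤ → ℝ}

/-- The terms are nonnegative, so where the real series converges it agrees with the sum in `ℝ≥0∞`,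
which is defined and measurable on all paths. -/
lemma pathSigma_sq_eq_of_hasSum (hα₀ : 0 ≤ α₀) (hα : ∀ i, 0 ≤ α i) (hβ : ∀ j, 0 ≤ β j) {t : ℤ}
    {Y : AGARCHIdx p q → ℝ}
    (hY : HasSum (fun k => pathProd α β γ z t k *ᵥ agarchVec p q α₀) Y) :
    pathSigma α β γ α₀ (fun s => z (s + t)) ^ 2 = Y (idxZero p q) := by
  have h1 := Pi.hasSum.mp hY (idxZero p q)
  have hnn : ∀ k, 0 ≤ (pathProd α β γ z t k *ᵥ agarchVec p q α₀) (idxZero p q) := fun k =>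
    mulVec_nonneg_of_nonneg (pathProd_nonneg γ z hα hβ t k) (agarchVec_nonneg hα₀) _
  rw [pathSigma_sq, pathVol_shift, ← ENNReal.ofReal_tsum_of_nonneg hnn h1.summable,
    ENNReal.toReal_ofReal (tsum_nonneg hnn), h1.tsum_eq]

lemma tsum_pathProd_recursion
    (hs : ∀ t, Summable fun k => pathProd α β γ z t k *ᵥ agarchVec p q α₀) (t : ℤ) :
    ∑' k, pathProd α β γ z t k *ᵥ agarchVec p q α₀ = agarchMatrix α β γ (z (t - 1)) *ᵥ
      (∑' k, pathProd α β γ z (t - 1) k *ᵥ agarchVec p q α₀) + agarchVec p q α₀ := by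
  have h1 : HasSum (fun k => pathProd α β γ z t (k + 1) *ᵥ agarchVec p q α₀)
      (agarchMatrix α β γ (z (t - 1)) *ᵥ
        (∑' k, pathProd α β γ z (t - 1) k *ᵥ agarchVec p q α₀)) := by
    have := (hs (t - 1)).hasSum.map (Matrix.mulVecLin (agarchMatrix α β γ (z (t - 1))))
      (LinearMap.continuous_of_finiteDimensional _)
    simpa only [Function.comp_def, Matrix.mulVecLin_apply, Matrix.mulVec_mulVec,
      ← pathProd_succ] using this
  rw [(hs t).tsum_eq_zero_add, h1.tsum_eq, pathProd_zero, Matrix.one_mulVec, add_comm]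

/-- The squared volatilities formed from a path of the noise satisfy the volatility equation. -/
lemma pathSigma_sq_eq_volRec (hα₀ : 0 ≤ α₀) (hα : ∀ i, 0 ≤ α i) (hβ : ∀ j, 0 ≤ β j)
    (hs : ∀ t, Summable fun k => pathProd α β γ z t k *ᵥ agarchVec p q α₀) (t : ℤ) :
    pathSigma α β γ α₀ (fun s => z (s + t)) ^ 2 =
      volRec α β γ z α₀ (fun u => pathSigma α β γ α₀ (fun s => z (s + u)) ^ 2) t := by
  simp only [fun u => pathSigma_sq_eq_of_hasSum hα₀ hα hβ (hs u).hasSum]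
  exact volRec_of_recursion α β γ z α₀ _ (tsum_pathProd_recursion hs) t

lemma summable_pathProd_mulVec {t : ℤ} (hs : Summable fun k => opNorm (pathProd α β γ z t k))
    (v : AGARCHIdx p q → ℝ) : Summable fun k => pathProd α β γ z t k *ᵥ v := by
  refine Pi.summable.mpr fun i => ?_
  refine Summable.of_norm_bounded (hs.mul_right (∑ j, |v j|)) fun k => ?_
  rw [Matrix.mulVec, dotProduct, Finset.mul_sum]
  refine (norm_sum_le _ _).trans (Finset.sum_le_sum fun j _ => ?_)
  rw [norm_mul]
  exact mul_le_mul_of_nonneg_right (abs_apply_le_opNorm _ i j) (abs_nonneg _)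

end PathVolatility

/-! ### Stationary solutions: existence, identification, ergodicity -/

section Stationary

variable {Ω : Type*} [mΩ : MeasurableSpace Ω] {P : Measure Ω}
  {Z : ℤ → Ω → ℝ} {p q : ℕ} {α : Fin p → ℝ} {β : Fin q → ℝ} {γ α₀ : ℝ}
  {X σ : ℤ → Ω → ℝ}

/-- If the series of matrix products converges, then it defines a stationary solution. -/
lemma isStationaryAGARCH_pathSigma (hZ_meas : ∀ t, Measurable (Z t)) (hZ_indep : iIndepFun Z P)
    (hZ_ident : ∀ t, IdentDistrib (Z t) (Z 0) P P)
    (hα₀ : 0 ≤ α₀) (hα : ∀ i, 0 ≤ α i) (hβ : ∀ j, 0 ≤ β j)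
    (hs : ∀ᵐ ω ∂P, ∀ t, Summable fun k =>
      pathProd α β γ (fun u => Z u ω) t k *ᵥ agarchVec p q α₀) :
    IsStationaryAGARCH P Z α₀ α β γ
      (fun t ω => pathSigma α β γ α₀ (fun s => Z (s + t) ω) * Z t ω)
      (fun t ω => pathSigma α β γ α₀ fun s => Z (s + t) ω) := by
  have hm : ∀ t, Measurable fun ω => pathSigma α β γ α₀ fun s => Z (s + t) ω := fun t =>
    measurable_pathSigma_shift_of α β γ α₀ fun s _ => hZ_meas s
  refine ⟨⟨fun t => (hm t).mul (hZ_meas t), hm,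
    Eventually.of_forall fun ω t => pathSigma_nonneg _ _ _ _ _,
    Eventually.of_forall fun ω t => rfl, ?_⟩, ?_⟩
  · filter_upwards [hs] with ω hω t
    rw [pathSigma_sq_eq_volRec hα₀ hα hβ hω t, volRec]
    congr 2
    refine Finset.sum_congr rfl fun i _ => ?_
    rw [asymSq_mul_of_nonneg _ (pathSigma_nonneg _ _ _ _ _), mul_comm (asymSq _ _)]
  · have hF : Measurable fun z : ℤ → ℝ =>
        (pathSigma α β γ α₀ z * z 0, pathSigma α β γ α₀ z) :=
      ((measurable_pathSigma α β γ α₀).mul (measurable_pi_apply 0)).prodMk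
        (measurable_pathSigma α β γ α₀)
    have := isStationaryProcess_of_eq hZ_meas hZ_indep hZ_ident hF
    simpa only [zero_add] using this

variable [IsProbabilityMeasure P]

/-- Every stationary solution is given by the series of matrix products. -/
lemma IsStationaryAGARCH.ae_hasSum (h : IsStationaryAGARCH P Z α₀ α β γ X σ)
    (hs : ∀ᵐ ω ∂P, ∀ t, Summable fun k => opNorm (pathProd α β γ (fun u => Z u ω) t k)) :
    ∀ᵐ ω ∂P, ∀ t, HasSum
      (fun k => pathProd α β γ (fun u => Z u ω) t k *ᵥ agarchVec p q α₀)
      (agarchState p q γ X σ t ω) := by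
  obtain ⟨hsol, hst⟩ := h
  rw [ae_all_iff]
  intro t
  set V : ℤ → Ω → ℝ := fun s ω => ∑ i, agarchState p q γ X σ s ω i with hV
  have hG : Measurable fun v : ℤ → ℝ × ℝ => ∑ i, agarchState p q γ
      (fun s (v : ℤ → ℝ × ℝ) => (v s).1) (fun s v => (v s).2) 0 v i := by
    refine Finset.measurable_sum _ fun i _ => ?_
    rcases i with i | i
    · simp only [agarchState]
      fun_prop
    · exact (measurable_asymSq γ).comp (measurable_pi_apply _).fst
  have hVid : ∀ s, IdentDistrib (V s) (V 0) P P := by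
    intro s
    have := (hst s).comp hG
    refine (congrArg₂ (fun f g => IdentDistrib f g P P) ?_ rfl).mp this
    ext ω
    simp only [Function.comp, hV]
    refine Finset.sum_congr rfl fun i _ => ?_
    rcases i with i | i
    · simp only [agarchState]
      congr 2
      ring
    · simp only [agarchState]
      rw [show (0 : ℤ) - ((i : ℕ) + 1) + s = s - ((i : ℕ) + 1) by ring]
  have hV0 : ∀ s ω i, 0 ≤ agarchState p q γ X σ s ω i := by
    intro s ω i
    rcases i with i | i
    · exact sq_nonneg _
    · exact asymSq_nonneg _ _
  have hV0m : Measurable (V 0) := hG.comp (g := fun v : ℤ → ℝ × ℝ => ∑ i, agarchState p q γ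
      (fun s (v : ℤ → ℝ × ℝ) => (v s).1) (fun s v => (v s).2) 0 v i)
    (f := fun ω t => (X t ω, σ t ω))
    (measurable_pi_iff.mpr fun t => (hsol.measurable_X t).prodMk (hsol.measurable_σ t))
  set N : Set Ω := {ω | ¬ HasSum
      (fun k => pathProd α β γ (fun u => Z u ω) t k *ᵥ agarchVec p q α₀)
      (agarchState p q γ X σ t ω)} with hN
  change P N = 0
  -- outside of a null set, the series can only fail if the state diverges in the past
  have hsub : ∀ K : ℕ, ∀ᵐ ω ∂P, ω ∈ N → ∀ᶠ n : ℕ in atTop, (K : ℝ) < V (t - n) ω := by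
    intro K
    filter_upwards [hs, hsol.ae_recursion, hsol.ae_state_eq] with ω h1 h2 h3 hωN
    by_contra hfr
    rw [Filter.not_eventually] at hfr
    refine hωN ?_
    have hsum := summable_pathProd_mulVec (h1 t) (agarchVec p q α₀)
    have hlim : ∀ i, Tendsto (fun n : ℕ =>
        (pathProd α β γ (fun u => Z u ω) t n *ᵥ agarchState p q γ X σ (t - n) ω) i) atTop
        (𝓝 (agarchState p q γ X σ t ω i - (∑' k, pathProd α β γ (fun u => Z u ω) t k *ᵥ
          agarchVec p q α₀) i)) := by
      intro i
      have h4 := (tendsto_pi_nhds.mp hsum.hasSum.tendsto_sum_nat i).const_sub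
        (agarchState p q γ X σ t ω i)
      refine h4.congr fun n => ?_
      have h5 := congrFun (eq_sum_add_pathProd_mulVec α β γ (fun u => Z u ω) α₀ _
        (pathState_recursion α β γ (fun u => Z u ω) _ α₀ h2) t n) i
      rw [← h3, ← h3, Pi.add_apply] at h5
      linarith
    -- The remainder converges, and along the infinitely many n with V (t - n) ≤ K it is at most K
    -- times a norm tending to 0. Hence its limit is 0.
    have hzero : ∀ i, agarchState p q γ X σ t ω i - (∑' k, pathProd α β γ (fun u => Z u ω) t k *ᵥ
          agarchVec p q α₀) i = 0 := by
      intro i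
      by_contra hne
      have hev := (hlim i).norm.eventually_const_lt
        (u := ‖_‖ / 2) (half_lt_self (norm_pos_iff.mpr hne))
      have hev2 := ((h1 t).tendsto_atTop_zero.mul_const (K : ℝ)).eventually_lt_const
        (u := ‖agarchState p q γ X σ t ω i - (∑' k, pathProd α β γ (fun u => Z u ω) t k *ᵥ
          agarchVec p q α₀) i‖ / 2) (by rw [zero_mul]; exact half_pos (norm_pos_iff.mpr hne))
      obtain ⟨n, hn1, hn2, hn3⟩ := (hfr.and_eventually (hev.and hev2)).exists
      refine absurd (hn2.trans_le ?_) (not_lt.mpr hn3.le)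
      rw [Matrix.mulVec, dotProduct]
      refine (norm_sum_le _ _).trans ?_
      calc ∑ j, ‖pathProd α β γ (fun u => Z u ω) t n i j * agarchState p q γ X σ (t - n) ω j‖
          ≤ ∑ j, opNorm (pathProd α β γ (fun u => Z u ω) t n) *
              agarchState p q γ X σ (t - n) ω j := by
            refine Finset.sum_le_sum fun j _ => ?_
            rw [norm_mul, Real.norm_of_nonneg (hV0 _ _ _)]
            exact mul_le_mul_of_nonneg_right (abs_apply_le_opNorm _ i j) (hV0 _ _ _)
        _ = opNorm (pathProd α β γ (fun u => Z u ω) t n) * V (t - n) ω := by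
            rw [← Finset.mul_sum]
        _ ≤ _ := mul_le_mul_of_nonneg_left (not_lt.mp hn1) (opNorm_nonneg _)
    have : agarchState p q γ X σ t ω = ∑' k, pathProd α β γ (fun u => Z u ω) t k *ᵥ
        agarchVec p q α₀ := funext fun i => sub_eq_zero.mp (hzero i)
    rw [this]
    exact hsum.hasSum
  by_contra hne
  have hpos : 0 < (P N).toReal := ENNReal.toReal_pos hne (measure_ne_top _ _)
  obtain ⟨K, hK⟩ := exists_measure_lt_of_measurable (P := P) hV0m hpos
  -- Exceeding K from some index on is an increasing union of events, the m-th contained in {K < V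
  -- (t - m)}; by stationarity all of these have the probability of {K < V 0}.
  have hle : P N ≤ P {ω | (K : ℝ) < V 0 ω} := by
    set E : ℕ → Set Ω := fun m => ⋂ n ≥ m, {ω | (K : ℝ) < V (t - (n : ℕ)) ω} with hE
    have hEmono : Monotone E := fun a b hab => Set.biInter_mono
      (fun n (hn : b ≤ n) => hab.trans hn) fun _ _ => subset_rfl
    have h1 : P N ≤ P (⋃ m, E m) := by
      refine measure_mono_ae ?_
      filter_upwards [hsub K] with ω hω hωN
      obtain ⟨m, hm⟩ := eventually_atTop.mp (hω hωN)
      refine Set.mem_iUnion.mpr ⟨m, Set.mem_iInter₂.mpr fun n hn => hm n hn⟩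
    refine h1.trans ?_
    rw [hEmono.measure_iUnion]
    refine iSup_le fun m => ?_
    refine (measure_mono (Set.biInter_subset_of_mem (le_refl m))).trans (le_of_eq ?_)
    exact (hVid (t - m)).measure_mem_eq measurableSet_Ioi
  have := ENNReal.toReal_mono (measure_ne_top _ _) hle
  rw [Measure.real] at hK
  linarith

section Consequences

variable (hZ_meas : ∀ t, Measurable (Z t)) (hZ_indep : iIndepFun Z P)
  (hZ_ident : ∀ t, IdentDistrib (Z t) (Z 0) P P) (hZ_var : ∫ ω, Z 0 ω ^ 2 ∂P = 1)
  (hγ : |γ| ≤ 1) (hα₀ : 0 < α₀) (hα : ∀ i, 0 ≤ α i) (hβ : ∀ j, 0 ≤ β j)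
include hZ_meas hZ_indep hZ_ident hZ_var hγ hα₀ hα hβ

lemma IsStationaryAGARCH.ae_hasSum_state (h : IsStationaryAGARCH P Z α₀ α β γ X σ) :
    ∀ᵐ ω ∂P, ∀ t, HasSum
      (fun k => pathProd α β γ (fun u => Z u ω) t k *ᵥ agarchVec p q α₀)
      (agarchState p q γ X σ t ω) :=
  h.ae_hasSum ((h.hasNegDrift hZ_meas hZ_ident hZ_var hγ hα₀ hα hβ).ae_summable
    hZ_meas hZ_indep hZ_ident hZ_var hγ hα)

/-- The sum of the series has σ_t² as first coordinate, and σ_t is its nonnegative root. Uniqueness,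
ergodicity and measurability in the past all rest on this formula. -/
lemma IsStationaryAGARCH.ae_eq_pathSigma (h : IsStationaryAGARCH P Z α₀ α β γ X σ) :
    ∀ᵐ ω ∂P, ∀ t, σ t ω = pathSigma α β γ α₀ (fun s => Z (s + t) ω) ∧
      X t ω = pathSigma α β γ α₀ (fun s => Z (s + t) ω) * Z t ω := by
  filter_upwards [h.ae_hasSum_state hZ_meas hZ_indep hZ_ident hZ_var hγ hα₀ hα hβ, h.1.nonneg,
    h.1.eq_X] with ω h1 h2 h3 t
  have h4 := pathSigma_sq_eq_of_hasSum (z := fun u => Z u ω) hα₀.le hα hβ (h1 t)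
  have h5 : agarchState p q γ X σ t ω (idxZero p q) = σ t ω ^ 2 := by simp [agarchState]
  have h6 : σ t ω = pathSigma α β γ α₀ (fun s => Z (s + t) ω) :=
    ((sq_eq_sq₀ (pathSigma_nonneg _ _ _ _ _) (h2 t)).mp (h4.trans h5)).symm
  exact ⟨h6, by rw [h3, h6]⟩

lemma IsStationaryAGARCH.ae_unique {X' σ' : ℤ → Ω → ℝ}
    (h : IsStationaryAGARCH P Z α₀ α β γ X σ) (h' : IsStationaryAGARCH P Z α₀ α β γ X' σ') :
    ∀ᵐ ω ∂P, ∀ t, X t ω = X' t ω ∧ σ t ω = σ' t ω := by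
  filter_upwards [h.ae_eq_pathSigma hZ_meas hZ_indep hZ_ident hZ_var hγ hα₀ hα hβ,
    h'.ae_eq_pathSigma hZ_meas hZ_indep hZ_ident hZ_var hγ hα₀ hα hβ] with ω h1 h2 t
  rw [(h1 t).1, (h1 t).2, (h2 t).1, (h2 t).2]
  exact ⟨rfl, rfl⟩

lemma IsStationaryAGARCH.ergodic_law (h : IsStationaryAGARCH P Z α₀ α β γ X σ) :
    IsErgodicProcess P (fun t ω => (X t ω, σ t ω)) := by
  have hF : Measurable fun z : ℤ → ℝ => (pathSigma α β γ α₀ z * z 0, pathSigma α β γ α₀ z) :=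
    ((measurable_pathSigma α β γ α₀).mul (measurable_pi_apply 0)).prodMk
      (measurable_pathSigma α β γ α₀)
  refine isErgodicProcess_of_ae_eq hZ_meas hZ_indep hZ_ident hF ?_
  filter_upwards [h.ae_eq_pathSigma hZ_meas hZ_indep hZ_ident hZ_var hγ hα₀ hα hβ] with ω hω t
  rw [(hω t).1, (hω t).2, zero_add]

lemma IsStationaryAGARCH.exists_measurable_pastSigma (h : IsStationaryAGARCH P Z α₀ α β γ X σ)
    (t : ℤ) : ∃ s : Ω → ℝ, Measurable[pastSigma Z (t - 1)] s ∧ σ t =ᵐ[P] s := by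
  -- `pastSigma Z (t - 1)` is by definition `noiseSigma Z (Set.Iic (t - 1))`.
  refine ⟨_, measurable_pathSigma_noiseSigma (α := α) (β := β) (γ := γ) (α₀ := α₀) t, ?_⟩
  filter_upwards [h.ae_eq_pathSigma hZ_meas hZ_indep hZ_ident hZ_var hγ hα₀ hα hβ] with ω hω
  exact (hω t).1

/-- The volatility is independent of the present noise. -/
lemma IsStationaryAGARCH.lintegral_sq_mul (h : IsStationaryAGARCH P Z α₀ α β γ X σ)
    {g : ℝ → ℝ≥0∞} (hg : Measurable g) (t : ℤ) :
    ∫⁻ ω, ENNReal.ofReal (σ t ω ^ 2) * g (Z t ω) ∂P =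
      (∫⁻ ω, ENNReal.ofReal (σ t ω ^ 2) ∂P) * ∫⁻ ω, g (Z 0 ω) ∂P := by
  have hae := h.ae_eq_pathSigma hZ_meas hZ_indep hZ_ident hZ_var hγ hα₀ hα hβ
  have hST : Disjoint (Set.Iic (t - 1)) {t} := by simp
  have hsq : Measurable fun x : ℝ => ENNReal.ofReal (x ^ 2) := by fun_prop
  have e0 : ∫⁻ ω, g (Z t ω) ∂P = ∫⁻ ω, g (Z 0 ω) ∂P := ((hZ_ident t).comp hg).lintegral_eq
  have e1 : ∫⁻ ω, ENNReal.ofReal (σ t ω ^ 2) ∂P =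
      ∫⁻ ω, ENNReal.ofReal (pathSigma α β γ α₀ (fun s => Z (s + t) ω) ^ 2) ∂P := by
    refine lintegral_congr_ae ?_
    filter_upwards [hae] with ω hω
    rw [(hω t).1]
  have e2 : ∫⁻ ω, ENNReal.ofReal (σ t ω ^ 2) * g (Z t ω) ∂P =
      ∫⁻ ω, ENNReal.ofReal (pathSigma α β γ α₀ (fun s => Z (s + t) ω) ^ 2) * g (Z t ω) ∂P := by
    refine lintegral_congr_ae ?_
    filter_upwards [hae] with ω hω
    rw [(hω t).1]
  rw [e1, e2, ← e0]
  exact lintegral_mul_of_noiseSigma hZ_meas hZ_indep hST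
    (hsq.comp (measurable_pathSigma_noiseSigma t))
    (hg.comp (measurable_noiseSigma (Set.mem_singleton t)))

end Consequences

end Stationary

/-! ### Moment conditions -/

section Moments

variable {Ω : Type*} [mΩ : MeasurableSpace Ω] {P : Measure Ω}
  {Z : ℤ → Ω → ℝ} {p q : ℕ} {α : Fin p → ℝ} {β : Fin q → ℝ} {γ α₀ : ℝ}
  {X σ : ℤ → Ω → ℝ}

lemma memLp_two_iff_lintegral_sq {f : Ω → ℝ} (hf : Measurable f) :
    MemLp f 2 P ↔ ∫⁻ ω, ENNReal.ofReal (f ω ^ 2) ∂P ≠ ⊤ := by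
  rw [memLp_two_iff_integrable_sq hf.aestronglyMeasurable, Integrable,
    hasFiniteIntegral_iff_ofReal (Eventually.of_forall fun ω => sq_nonneg _), lt_top_iff_ne_top]
  exact and_iff_right (hf.pow_const 2).aestronglyMeasurable

/-- The existence of any solution forces `∑ β_j < 1`. -/
lemma IsAGARCHSolution.sum_lt_one [IsProbabilityMeasure P]
    (hsol : IsAGARCHSolution P Z α₀ α β γ X σ) (hα₀ : 0 < α₀) (hα : ∀ i, 0 ≤ α i)
    (hβ : ∀ j, 0 ≤ β j) : ∑ j, β j < 1 := by
  by_contra hge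
  push Not at hge
  obtain ⟨ω, hω⟩ := hsol.eq_σ.exists
  -- With ∑ β_j ≥ 1, each use of the equation raises a lower bound uniform in t by α₀.
  have hlow : ∀ (n : ℕ) (t : ℤ), n * α₀ ≤ σ t ω ^ 2 := by
    intro n
    induction n with
    | zero => intro t; simpa using sq_nonneg (σ t ω)
    | succ n ih =>
      intro t
      rw [hω t]
      have h1 : 0 ≤ ∑ i : Fin p, α i * asymSq γ (X (t - ((i : ℕ) + 1)) ω) :=
        Finset.sum_nonneg fun i _ => mul_nonneg (hα i) (asymSq_nonneg _ _)
      have h2 : ∑ j : Fin q, β j * (n * α₀) ≤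
          ∑ j : Fin q, β j * σ (t - ((j : ℕ) + 1)) ω ^ 2 :=
        Finset.sum_le_sum fun j _ => mul_le_mul_of_nonneg_left (ih _) (hβ j)
      rw [← Finset.sum_mul] at h2
      have h3 : 1 * (n * α₀) ≤ (∑ j, β j) * (n * α₀) :=
        mul_le_mul_of_nonneg_right hge (by positivity)
      push_cast
      linarith
  obtain ⟨n, hn⟩ := exists_nat_gt (σ 0 ω ^ 2 / α₀)
  rw [div_lt_iff₀ hα₀] at hn
  linarith [hlow n 0]

/-- Lets the mean of (|Z_0| - γ Z_0)² be realized by a constant noise value. The sign of x is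
opposite to that of γ, so that the denominator 1 + |γ| does not vanish. -/
lemma exists_asymSq_eq (γ : ℝ) {m : ℝ} (hm : 0 ≤ m) : ∃ x, asymSq γ x = m := by
  have hs := Real.sqrt_nonneg m
  rcases le_total 0 γ with h | h
  · refine ⟨-(√m / (1 + γ)), ?_⟩
    have : 0 < 1 + γ := by linarith
    rw [asymSq, abs_neg, abs_of_nonneg (by positivity)]
    rw [show √m / (1 + γ) - γ * -(√m / (1 + γ)) = √m by field_simp; ring, Real.sq_sqrt hm]
  · refine ⟨√m / (1 - γ), ?_⟩
    have : 0 < 1 - γ := by linarith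
    rw [asymSq, abs_of_nonneg (by positivity)]
    rw [show √m / (1 - γ) - γ * (√m / (1 - γ)) = √m by field_simp, Real.sq_sqrt hm]

/-- Under the moment condition, the series along a constant path converges. -/
lemma summable_pathProd_const (hα₀ : 0 ≤ α₀) (hα : ∀ i, 0 ≤ α i) (hβ : ∀ j, 0 ≤ β j) {x : ℝ}
    (hc : ∑ i, α i * asymSq γ x + ∑ j, β j < 1) (t : ℤ) (i : AGARCHIdx p q) :
    Summable fun k => (pathProd α β γ (fun _ => x) t k *ᵥ agarchVec p q α₀) i := by
  set c := ∑ i, α i * asymSq γ x + ∑ j, β j with hcdef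
  have hc' : 0 < 1 - c := by linarith
  -- The constant solution along constant noise; its state bounds all partial sums of the series.
  set H := α₀ / (1 - c) with hH
  have hH0 : 0 ≤ H := by positivity
  have hrec : ∀ t : ℤ, (fun _ : ℤ => H) t = volRec α β γ (fun _ => x) α₀ (fun _ => H) t := by
    intro t
    simp only [volRec]
    have e : α₀ + ∑ i : Fin p, α i * (asymSq γ x * H) + ∑ j : Fin q, β j * H = α₀ + c * H := by
      rw [hcdef, add_mul, Finset.sum_mul, Finset.sum_mul, add_assoc]
      congr 2
      exact Finset.sum_congr rfl fun i _ => by ring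
    rw [e, hH]
    field_simp
    ring
  refine summable_of_sum_range_le (c := pathState p q γ (fun _ => H) (fun _ => x) t i)
    (fun k => mulVec_nonneg_of_nonneg (pathProd_nonneg γ _ hα hβ t k) (agarchVec_nonneg hα₀) i)
    fun n => ?_
  have h1 := congrFun (eq_sum_add_pathProd_mulVec α β γ (fun _ => x) α₀ _
    (pathState_recursion α β γ (fun _ => x) _ α₀ hrec) t n) i
  rw [Pi.add_apply, Finset.sum_apply] at h1
  have h2 := mulVec_nonneg_of_nonneg (pathProd_nonneg γ (fun _ => x) hα hβ t n)
    (pathState_nonneg (p := p) (q := q) (γ := γ) (z := fun _ => x) (fun _ => hH0) (t - n)) i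
  linarith

variable [IsProbabilityMeasure P]

/-- The mean of the terms of the series is computed along a constant path of the noise. -/
lemma lintegral_pathProd_mulVec (hZ_meas : ∀ t, Measurable (Z t)) (hZ_indep : iIndepFun Z P)
    (hZ_ident : ∀ t, IdentDistrib (Z t) (Z 0) P P) (hZ_var : ∫ ω, Z 0 ω ^ 2 ∂P = 1)
    (hγ : |γ| ≤ 1) (hα₀ : 0 ≤ α₀) (hα : ∀ i, 0 ≤ α i) (hβ : ∀ j, 0 ≤ β j) {x : ℝ}
    (hx : asymSq γ x = ∫ ω, asymSq γ (Z 0 ω) ∂P) (t : ℤ) (k : ℕ) (i : AGARCHIdx p q) :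
    ∫⁻ ω, ENNReal.ofReal
      ((pathProd α β γ (fun u => Z u ω) t k *ᵥ agarchVec p q α₀) i) ∂P =
      ENNReal.ofReal ((pathProd α β γ (fun _ => x) t k *ᵥ agarchVec p q α₀) i) := by
  -- An entry is affine in (|z| - γ z)², so its mean is its value at x.
  have hentry : ∀ (s : ℤ) (i j : AGARCHIdx p q),
      ∫⁻ ω, ENNReal.ofReal (agarchMatrix α β γ (Z s ω) i j) ∂P =
        ENNReal.ofReal (agarchMatrix α β γ x i j) := by
    intro s i j
    obtain ⟨b, -, hb⟩ := exists_agarchMatrix_eq_add_mul α β γ hα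
    have h0 : ∫⁻ ω, ENNReal.ofReal (agarchMatrix α β γ (Z s ω) i j) ∂P =
        ∫⁻ ω, ENNReal.ofReal (agarchMatrix α β γ (Z 0 ω) i j) ∂P :=
      ((hZ_ident s).comp (measurable_agarchMatrix α β γ i j).ennreal_ofReal).lintegral_eq
    have hint := integrable_asymSq hZ_meas hγ hZ_var
    have hfun : (fun ω => agarchMatrix α β γ (Z 0 ω) i j) =
        fun ω => agarchMatrix α β γ 0 i j + b i j * asymSq γ (Z 0 ω) :=
      funext fun ω => hb (Z 0 ω) i j
    have hint' : Integrable (fun ω => agarchMatrix α β γ (Z 0 ω) i j) P := by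
      rw [hfun]
      exact (integrable_const _).add (hint.const_mul _)
    rw [h0, ← ofReal_integral_eq_lintegral_ofReal hint'
      (Eventually.of_forall fun ω => agarchMatrix_nonneg γ hα hβ _ i j), hfun,
      integral_add (integrable_const _) (hint.const_mul _), integral_const_mul, ← hx, hb x i j]
    simp
  have hnn : ∀ (z : ℤ → ℝ) (t : ℤ) (k : ℕ) (j : AGARCHIdx p q),
      0 ≤ (pathProd α β γ z t k *ᵥ agarchVec p q α₀) j := fun z t k j =>
    mulVec_nonneg_of_nonneg (pathProd_nonneg γ z hα hβ t k) (agarchVec_nonneg hα₀) j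
  have hstep : ∀ (z : ℤ → ℝ) (t : ℤ) (k : ℕ) (i : AGARCHIdx p q), ENNReal.ofReal
      ((pathProd α β γ z t (k + 1) *ᵥ agarchVec p q α₀) i) =
      ∑ j, ENNReal.ofReal (agarchMatrix α β γ (z (t - 1)) i j) *
        ENNReal.ofReal ((pathProd α β γ z (t - 1) k *ᵥ agarchVec p q α₀) j) := by
    intro z t k i
    rw [pathProd_succ, ← Matrix.mulVec_mulVec, Matrix.mulVec, dotProduct,
      ENNReal.ofReal_sum_of_nonneg fun j _ =>
        mul_nonneg (agarchMatrix_nonneg γ hα hβ _ _ _) (hnn _ _ _ _)]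
    exact Finset.sum_congr rfl fun j _ => ENNReal.ofReal_mul (agarchMatrix_nonneg γ hα hβ _ _ _)
  induction k generalizing t i with
  | zero => simp
  | succ k ih =>
    simp only [hstep]
    have hm1 : ∀ j, Measurable[noiseSigma Z {t - 1}]
        fun ω => ENNReal.ofReal (agarchMatrix α β γ (Z (t - 1) ω) i j) := fun j =>
      (measurable_agarchMatrix α β γ i j).ennreal_ofReal.comp
        (measurable_noiseSigma (Set.mem_singleton (t - 1)))
    have hm2 : ∀ j, Measurable[noiseSigma Z (Set.Ico (t - 1 - k) (t - 1))] fun ω =>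
        ENNReal.ofReal
          ((pathProd α β γ (fun u => Z u ω) (t - 1) k *ᵥ agarchVec p q α₀) j) := fun j =>
      ENNReal.measurable_ofReal.comp (measurable_mulVec_agarchVec_of α₀
        (fun i j => measurable_pathProd_noiseSigma α β γ (t - 1) k i j) j)
    have hm : ∀ j, Measurable fun ω => ENNReal.ofReal (agarchMatrix α β γ (Z (t - 1) ω) i j) *
        ENNReal.ofReal
          ((pathProd α β γ (fun u => Z u ω) (t - 1) k *ᵥ agarchVec p q α₀) j) := fun j =>
      ((hm1 j).mono (noiseSigma_le hZ_meas _) le_rfl).mul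
        ((hm2 j).mono (noiseSigma_le hZ_meas _) le_rfl)
    rw [lintegral_finsetSum _ fun j _ => hm j]
    refine Finset.sum_congr rfl fun j _ => ?_
    rw [lintegral_mul_of_noiseSigma hZ_meas hZ_indep (by simp) (hm1 j) (hm2 j), hentry, ih]

section Consequences

variable (hZ_meas : ∀ t, Measurable (Z t)) (hZ_indep : iIndepFun Z P)
  (hZ_ident : ∀ t, IdentDistrib (Z t) (Z 0) P P) (hZ_var : ∫ ω, Z 0 ω ^ 2 ∂P = 1)
  (hγ : |γ| ≤ 1) (hα₀ : 0 < α₀) (hα : ∀ i, 0 ≤ α i) (hβ : ∀ j, 0 ≤ β j)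
include hZ_meas hZ_indep hZ_ident hZ_var hγ hα₀ hα hβ

lemma lintegral_tsum_ne_top
    (hc : ∑ i, α i * (∫ ω, asymSq γ (Z 0 ω) ∂P) + ∑ j, β j < 1) (t : ℤ) (i : AGARCHIdx p q) :
    ∫⁻ ω, ∑' k, ENNReal.ofReal
      ((pathProd α β γ (fun u => Z u ω) t k *ᵥ agarchVec p q α₀) i) ∂P ≠ ⊤ := by
  obtain ⟨x, hx⟩ := exists_asymSq_eq γ
    (integral_nonneg fun ω => asymSq_nonneg γ (Z 0 ω) : 0 ≤ ∫ ω, asymSq γ (Z 0 ω) ∂P)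
  rw [← hx] at hc
  rw [lintegral_tsum fun k => ((measurable_mulVec_agarchVec_of α₀ (fun i j =>
    measurable_pathProd_of α β γ t k (fun s _ _ => hZ_meas s) i j) i).ennreal_ofReal).aemeasurable]
  simp only [lintegral_pathProd_mulVec hZ_meas hZ_indep hZ_ident hZ_var hγ hα₀.le hα hβ hx]
  exact (summable_pathProd_const hα₀.le hα hβ hc t i).tsum_ofReal_ne_top

lemma ae_summable_of_moment
    (hc : ∑ i, α i * (∫ ω, asymSq γ (Z 0 ω) ∂P) + ∑ j, β j < 1) :
    ∀ᵐ ω ∂P, ∀ t, Summable fun k =>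
      pathProd α β γ (fun u => Z u ω) t k *ᵥ agarchVec p q α₀ := by
  rw [ae_all_iff]
  intro t
  have hm : ∀ k (i : AGARCHIdx p q), Measurable fun ω => ENNReal.ofReal
      ((pathProd α β γ (fun u => Z u ω) t k *ᵥ agarchVec p q α₀) i) := fun k i =>
    (measurable_mulVec_agarchVec_of α₀ (fun i j =>
      measurable_pathProd_of α β γ t k (fun s _ _ => hZ_meas s) i j) i).ennreal_ofReal
  have h : ∀ᵐ ω ∂P, ∀ i : AGARCHIdx p q, ∑' k, ENNReal.ofReal
      ((pathProd α β γ (fun u => Z u ω) t k *ᵥ agarchVec p q α₀) i) < ⊤ := by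
    rw [ae_all_iff]
    exact fun i => ae_lt_top (Measurable.tsum fun k => hm k i)
      (lintegral_tsum_ne_top hZ_meas hZ_indep hZ_ident hZ_var hγ hα₀ hα hβ hc t i)
  filter_upwards [h] with ω hω
  refine Pi.summable.mpr fun i => ?_
  refine (ENNReal.summable_toReal (hω i).ne).congr fun k => ?_
  exact ENNReal.toReal_ofReal
    (mulVec_nonneg_of_nonneg (pathProd_nonneg γ _ hα hβ t k) (agarchVec_nonneg hα₀.le) i)

lemma IsStationaryAGARCH.lintegral_sq_eq (h : IsStationaryAGARCH P Z α₀ α β γ X σ) (t : ℤ) :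
    ∫⁻ ω, ENNReal.ofReal (X t ω ^ 2) ∂P = ∫⁻ ω, ENNReal.ofReal (σ t ω ^ 2) ∂P := by
  have h1 := h.lintegral_sq_mul hZ_meas hZ_indep hZ_ident hZ_var hγ hα₀ hα hβ
    (g := fun x => ENNReal.ofReal (x ^ 2)) (by fun_prop) t
  rw [← ofReal_integral_eq_lintegral_ofReal (integrable_sq_of_integral_eq_one hZ_var)
    (Eventually.of_forall fun ω => sq_nonneg _), hZ_var, ENNReal.ofReal_one, mul_one] at h1
  rw [← h1]
  refine lintegral_congr_ae ?_
  filter_upwards [h.1.eq_X] with ω hω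
  rw [hω, mul_pow, ENNReal.ofReal_mul (sq_nonneg _)]

/-- σ_t is independent of Z_t and E Z_t² = 1, so X_t and σ_t have equal second moments; the two
moment criteria therefore agree. -/
lemma IsStationaryAGARCH.memLp_iff (h : IsStationaryAGARCH P Z α₀ α β γ X σ) (t : ℤ) :
    MemLp (X t) 2 P ↔ MemLp (σ t) 2 P := by
  rw [memLp_two_iff_lintegral_sq (h.1.measurable_X t),
    memLp_two_iff_lintegral_sq (h.1.measurable_σ t),
    h.lintegral_sq_eq hZ_meas hZ_indep hZ_ident hZ_var hγ hα₀ hα hβ]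

/-- A stationary solution with finite second moments forces the moment condition. -/
lemma IsStationaryAGARCH.moment_lt_one (h : IsStationaryAGARCH P Z α₀ α β γ X σ)
    (hmem : MemLp (σ 0) 2 P) :
    ∑ i, α i * (∫ ω, asymSq γ (Z 0 ω) ∂P) + ∑ j, β j < 1 := by
  set m := ∫ ω, asymSq γ (Z 0 ω) ∂P with hm
  have hm0 : 0 ≤ m := integral_nonneg fun ω => asymSq_nonneg γ (Z 0 ω)
  have hσm := h.1.measurable_σ
  set S := ∫⁻ ω, ENNReal.ofReal (σ 0 ω ^ 2) ∂P with hS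
  have hStop : S ≠ ⊤ := (memLp_two_iff_lintegral_sq (hσm 0)).mp hmem
  have hSt : ∀ t, ∫⁻ ω, ENNReal.ofReal (σ t ω ^ 2) ∂P = S := by
    intro t
    have hG : Measurable fun v : ℤ → ℝ × ℝ => ENNReal.ofReal ((v 0).2 ^ 2) := by fun_prop
    have := ((h.2 t).comp hG).lintegral_eq
    simpa [Function.comp_def] using this
  have hXt : ∀ t, ∫⁻ ω, ENNReal.ofReal (asymSq γ (X t ω)) ∂P = S * ENNReal.ofReal m := by
    intro t
    have h1 := h.lintegral_sq_mul hZ_meas hZ_indep hZ_ident hZ_var hγ hα₀ hα hβ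
      (g := fun x => ENNReal.ofReal (asymSq γ x)) (measurable_asymSq γ).ennreal_ofReal t
    rw [hSt, ← ofReal_integral_eq_lintegral_ofReal (integrable_asymSq hZ_meas hγ hZ_var)
      (Eventually.of_forall fun ω => asymSq_nonneg _ _)] at h1
    rw [hm, ← h1]
    refine lintegral_congr_ae ?_
    filter_upwards [h.1.eq_X, h.1.nonneg] with ω hω h0
    rw [hω, asymSq_mul_of_nonneg _ (h0 t), ENNReal.ofReal_mul (sq_nonneg _)]
  have heq : S = ENNReal.ofReal α₀ + ∑ i, ENNReal.ofReal (α i) * (S * ENNReal.ofReal m) +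
      ∑ j, ENNReal.ofReal (β j) * S := by
    have hmX : ∀ i : Fin p, Measurable fun ω =>
        ENNReal.ofReal (α i) * ENNReal.ofReal (asymSq γ (X (0 - ((i : ℕ) + 1)) ω)) := fun i =>
      ((measurable_asymSq γ).comp (h.1.measurable_X _)).ennreal_ofReal.const_mul _
    have hmσ : ∀ j : Fin q, Measurable fun ω =>
        ENNReal.ofReal (β j) * ENNReal.ofReal (σ (0 - ((j : ℕ) + 1)) ω ^ 2) := fun j =>
      ((hσm _).pow_const 2).ennreal_ofReal.const_mul _
    have hae : ∀ᵐ ω ∂P, ENNReal.ofReal (σ 0 ω ^ 2) = ENNReal.ofReal α₀ +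
        ∑ i : Fin p, ENNReal.ofReal (α i) * ENNReal.ofReal (asymSq γ (X (0 - ((i : ℕ) + 1)) ω)) +
        ∑ j : Fin q, ENNReal.ofReal (β j) * ENNReal.ofReal (σ (0 - ((j : ℕ) + 1)) ω ^ 2) := by
      filter_upwards [h.1.eq_σ] with ω hω
      have h1 : ∀ i : Fin p, 0 ≤ α i * asymSq γ (X (0 - ((i : ℕ) + 1)) ω) := fun i =>
        mul_nonneg (hα i) (asymSq_nonneg _ _)
      have h2 : ∀ j : Fin q, 0 ≤ β j * σ (0 - ((j : ℕ) + 1)) ω ^ 2 := fun j =>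
        mul_nonneg (hβ j) (sq_nonneg _)
      rw [hω 0, ENNReal.ofReal_add (add_nonneg hα₀.le (Finset.sum_nonneg fun i _ => h1 i))
        (Finset.sum_nonneg fun j _ => h2 j),
        ENNReal.ofReal_add hα₀.le (Finset.sum_nonneg fun i _ => h1 i),
        ENNReal.ofReal_sum_of_nonneg fun i _ => h1 i, ENNReal.ofReal_sum_of_nonneg fun j _ => h2 j]
      simp only [ENNReal.ofReal_mul (hα _), ENNReal.ofReal_mul (hβ _)]
    conv_lhs => rw [hS, lintegral_congr_ae hae]
    rw [lintegral_add_right _ (Finset.measurable_sum _ fun j _ => hmσ j),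
      lintegral_add_left measurable_const, lintegral_finsetSum _ fun i _ => hmX i,
      lintegral_finsetSum _ fun j _ => hmσ j]
    simp only [lintegral_const, measure_univ, mul_one, lintegral_const_mul' _ _ ENNReal.ofReal_ne_top,
      hXt, hSt]
  set s := S.toReal with hs
  have hs0 : 0 ≤ s := ENNReal.toReal_nonneg
  -- The mean of the volatility equation, read in ℝ because S is finite. As α₀ > 0 and s ≥ 0, the
  -- coefficient of s cannot be 1 or more.
  have hreal : s = α₀ + (∑ i, α i * m + ∑ j, β j) * s := by
    have hSs : S = ENNReal.ofReal s := (ENNReal.ofReal_toReal hStop).symm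
    have h1 : ∀ i, 0 ≤ α i * (s * m) := fun i => mul_nonneg (hα i) (mul_nonneg hs0 hm0)
    have h2 : ∀ j, 0 ≤ β j * s := fun j => mul_nonneg (hβ j) hs0
    rw [hSs] at heq
    simp only [← ENNReal.ofReal_mul hs0, ← ENNReal.ofReal_mul (hα _),
      ← ENNReal.ofReal_mul (hβ _)] at heq
    rw [← ENNReal.ofReal_sum_of_nonneg fun i _ => h1 i,
      ← ENNReal.ofReal_sum_of_nonneg fun j _ => h2 j,
      ← ENNReal.ofReal_add hα₀.le (Finset.sum_nonneg fun i _ => h1 i),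
      ← ENNReal.ofReal_add (add_nonneg hα₀.le (Finset.sum_nonneg fun i _ => h1 i))
        (Finset.sum_nonneg fun j _ => h2 j),
      ENNReal.ofReal_eq_ofReal_iff hs0 (add_nonneg (add_nonneg hα₀.le
        (Finset.sum_nonneg fun i _ => h1 i)) (Finset.sum_nonneg fun j _ => h2 j))] at heq
    rw [add_mul, Finset.sum_mul, Finset.sum_mul, ← add_assoc]
    conv_lhs => rw [heq]
    congr 2
    exact Finset.sum_congr rfl fun i _ => by ring
  by_contra hge
  push Not at hge
  have := mul_le_mul_of_nonneg_right hge hs0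
  linarith

/-- Under the moment condition there is a stationary solution with finite second moments. -/
lemma exists_isStationaryAGARCH_of_moment
    (hc : ∑ i, α i * (∫ ω, asymSq γ (Z 0 ω) ∂P) + ∑ j, β j < 1) :
    ∃ X σ : ℤ → Ω → ℝ, IsStationaryAGARCH P Z α₀ α β γ X σ ∧
      ∀ t, MemLp (X t) 2 P ∧ MemLp (σ t) 2 P := by
  have h := isStationaryAGARCH_pathSigma hZ_meas hZ_indep hZ_ident hα₀.le hα hβ
    (ae_summable_of_moment hZ_meas hZ_indep hZ_ident hZ_var hγ hα₀ hα hβ hc)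
  have hσ : ∀ t, MemLp (fun ω => pathSigma α β γ α₀ fun s => Z (s + t) ω) 2 P := by
    intro t
    rw [memLp_two_iff_lintegral_sq (h.1.measurable_σ t)]
    refine ne_top_of_le_ne_top (lintegral_tsum_ne_top hZ_meas hZ_indep hZ_ident hZ_var hγ hα₀ hα
      hβ hc t (idxZero p q)) (lintegral_mono fun ω => ?_)
    rw [pathSigma_sq, pathVol_shift α β γ α₀ (fun s => Z s ω)]
    exact ENNReal.ofReal_toReal_le
  exact ⟨_, _, h, fun t =>
    ⟨(h.memLp_iff hZ_meas hZ_indep hZ_ident hZ_var hγ hα₀ hα hβ t).mpr (hσ t), hσ t⟩⟩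

lemma existsUniqueProcess_iff_hasNegDrift :
    ExistsUniqueProcess P (IsStationaryAGARCH P Z α₀ α β γ) ↔ HasNegDrift α β γ P Z := by
  constructor
  · rintro ⟨⟨X, σ, h⟩, -⟩
    exact h.hasNegDrift hZ_meas hZ_ident hZ_var hγ hα₀ hα hβ
  · intro hneg
    refine ⟨⟨_, _, isStationaryAGARCH_pathSigma hZ_meas hZ_indep hZ_ident hα₀.le hα hβ ?_⟩,
      fun X σ X' σ' h h' => h.ae_unique hZ_meas hZ_indep hZ_ident hZ_var hγ hα₀ hα hβ h'⟩
    filter_upwards [hneg.ae_summable hZ_meas hZ_indep hZ_ident hZ_var hγ hα] with ω hω t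
    exact summable_pathProd_mulVec (hω t) _

end Consequences

end Moments

end

theorem theorem3p5 {Ω : Type*} [MeasurableSpace Ω] (P : Measure Ω) [IsProbabilityMeasure P]
    -- the noise: i.i.d., centered, with unit variance
    (Z : ℤ → Ω → ℝ) (hZ_meas : ∀ t, Measurable (Z t)) (hZ_indep : iIndepFun Z P)
    (hZ_ident : ∀ t, IdentDistrib (Z t) (Z 0) P P)
    (hZ_mean : ∫ ω, Z 0 ω ∂P = 0) (hZ_var : ∫ ω, Z 0 ω ^ 2 ∂P = 1)
    -- the parameters
    (p q : ℕ) (α₀ : ℝ) (α : Fin p → ℝ) (β : Fin q → ℝ) (γ : ℝ)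
    (hα₀ : 0 < α₀) (hα : ∀ i, 0 ≤ α i) (hβ : ∀ j, 0 ≤ β j) (hγ : |γ| ≤ 1) :
    -- the top Lyapunov exponent exists, and its sign decides about unique stationary solvability
    (∃ ρ : EReal, IsTopLyapunovExponent P α β γ Z ρ ∧
      (ExistsUniqueProcess P (IsStationaryAGARCH P Z α₀ α β γ) ↔ ρ < 0)) ∧
    -- the stationary solution is ergodic, nonanticipative, and given by the series
    (∀ X σ : ℤ → Ω → ℝ, IsStationaryAGARCH P Z α₀ α β γ X σ →
      IsErgodicProcess P (fun t ω => (X t ω, σ t ω)) ∧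
      (∀ t, ∃ s : Ω → ℝ, Measurable[pastSigma Z (t - 1)] s ∧ σ t =ᵐ[P] s) ∧
      (∀ᵐ ω ∂P, ∀ t, HasSum
        (fun k : ℕ => agarchProd α β γ Z t k ω *ᵥ agarchVec p q α₀)
        (agarchState p q γ X σ t ω))) ∧
    -- a necessary condition for the existence of a stationary solution
    ((∃ X σ : ℤ → Ω → ℝ, IsStationaryAGARCH P Z α₀ α β γ X σ) → ∑ j, β j < 1) ∧
    -- stationary solutions with finite second moments, of `X_t` or of the pair `(X_t, σ_t)`
    (∑ i, α i * (∫ ω, asymSq γ (Z 0 ω) ∂P) + ∑ j, β j < 1 ↔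
      ExistsUniqueProcess P (fun X σ => IsStationaryAGARCH P Z α₀ α β γ X σ ∧
        ∀ t, MemLp (X t) 2 P)) ∧
    (∑ i, α i * (∫ ω, asymSq γ (Z 0 ω) ∂P) + ∑ j, β j < 1 ↔
      ExistsUniqueProcess P (fun X σ => IsStationaryAGARCH P Z α₀ α β γ X σ ∧
        ∀ t, MemLp (X t) 2 P ∧ MemLp (σ t) 2 P)) := by

  refine ⟨?_, fun X σ h => ⟨?_, ?_, ?_⟩, ?_, ?_, ?_⟩
  · obtain ⟨ρ, h1, h2⟩ :=
      exists_isTopLyapunovExponent α β hZ_meas hZ_indep hZ_ident hZ_var hγ hα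
    exact ⟨ρ, h1, (existsUniqueProcess_iff_hasNegDrift hZ_meas hZ_indep hZ_ident hZ_var hγ hα₀
      hα hβ).trans h2.symm⟩
  · exact h.ergodic_law hZ_meas hZ_indep hZ_ident hZ_var hγ hα₀ hα hβ
  · exact h.exists_measurable_pastSigma hZ_meas hZ_indep hZ_ident hZ_var hγ hα₀ hα hβ
  · exact h.ae_hasSum_state hZ_meas hZ_indep hZ_ident hZ_var hγ hα₀ hα hβ
  · rintro ⟨X, σ, h⟩
    exact h.1.sum_lt_one hα₀ hα hβ
  · constructor
    · intro hc
      obtain ⟨X, σ, h, hm⟩ := exists_isStationaryAGARCH_of_moment hZ_meas hZ_indep hZ_ident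
        hZ_var hγ hα₀ hα hβ hc
      exact ⟨⟨X, σ, h, fun t => (hm t).1⟩, fun X σ X' σ' h h' =>
        h.1.ae_unique hZ_meas hZ_indep hZ_ident hZ_var hγ hα₀ hα hβ h'.1⟩
    · rintro ⟨⟨X, σ, h, hm⟩, -⟩
      exact h.moment_lt_one hZ_meas hZ_indep hZ_ident hZ_var hγ hα₀ hα hβ
        ((h.memLp_iff hZ_meas hZ_indep hZ_ident hZ_var hγ hα₀ hα hβ 0).mp (hm 0))
  · constructor
    · intro hc
      exact ⟨exists_isStationaryAGARCH_of_moment hZ_meas hZ_indep hZ_ident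
        hZ_var hγ hα₀ hα hβ hc, fun X σ X' σ' h h' =>
        h.1.ae_unique hZ_meas hZ_indep hZ_ident hZ_var hγ hα₀ hα hβ h'.1⟩
    · rintro ⟨⟨X, σ, h, hm⟩, -⟩
      exact h.moment_lt_one hZ_meas hZ_indep hZ_ident hZ_var hγ hα₀ hα hβ (hm 0).2
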